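/- Let $\mathcal H_A,\mathcal H_B,\mathcal H_C$ be copies of $L^2(\mathbb R)$, and let $\hat x$ (multiplication by $x$, on its maximal domain) and $\hat p=-i\,d/dx$ (on $H^1(\mathbb R)$, with $\hbar=1$) be the position and momentum operators on $L^2(\mathbb R)$; a subscript $B$ or $C$ names the factor on which they act. For $P\in\mathbb R$ let $$\hat S^P=\hat{\mathcal P}_{AC}\,e^{i\hat x_C(\hat p_B-P)}:\ \mathcal H_B\otimes\mathcal H_C\to\mathcal H_A\otimes\mathcal H_B$$ be the quantum reference frame transformation from $A$ to $C$ in the sector of total momentum $P$. Here $(e^{i\hat x_C(\hat p_B-P)}\psi)(y,z)=e^{-izP}\psi(y+z,z)$, and $\hat{\mathcal P}_{AC}=\int dx\,|{-x}\rangle_A\langle x|_C$ is the parity swap, $(\hat{\mathcal P}_{AC}\psi)(x_A,x_B)=\psi(x_B,-x_A)$. A bounded operator $\hat O$ on $\mathcal H_B\otimes\mathcal H_C$ is called invariant in the sector $P$ if $\hat S^P\hat O(\hat S^P)^\dagger=\hat{\mathcal P}_{AC}\hat O\hat{\mathcal P}_{AC}^\dagger$. For a bounded operator $\hat O$ and an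 unbounded operator $\hat T$ on $L^2(\mathbb R)$, $[\hat T,\hat O]=0$ (respectively $\{\hat T,\hat O\}=0$) means that $\hat O$ maps the domain of $\hat T$ into itself and that $\hat T\hat Of-\hat O\hat Tf=0$ (respectively $\hat T\hat Of+\hat O\hat Tf=0$) for all $f$ in this domain. Let $\hat O=\hat O_B\otimes\hat O_C$, with $\hat O_B,\hat O_C$ bounded operators on $L^2(\mathbb R)$, be a non-zero Hermitian operator that is invariant in the sector $P=0$. Then: 1. For every $P\neq0$, $\hat O$ fails to be invariant in the sector $P$ if and only if $\{\hat p_B,\hat O_B\}=0$ and $\{\hat x_C,\hat O_C\}=0$. 2. Exactly one of the following two cases occurs: (commuting case) $[\hat p_B,\hat O_B]=0$ and $[\hat x_C,\hat O_C]=0$; (anticommuting case) $\{\hat p_B,\hat O_B\}=0$ and $\{\hat x_C,\hat O_C\}=0$. 3. In the commuting case $\hat O$ is invariant in the sector $P$ for every $P\in\mathbb R$. -/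

import Mathlib

open MeasureTheory
open scoped ENNReal SchwartzMap

noncomputable section

namespace QRF

/-- The state space `L²(ℝ)` of one particle on the line. -/
abbrev H1 : Type := Lp ℂ 2 (volume : Measure ℝ)

/-- The state space `L²(ℝ) ⊗ L²(ℝ) = L²(ℝ²)` of two particles on the line. Relative to `A` the
arguments of a wave function are `(x_B, x_C)`; relative to `C` they are `(x_A, x_B)`. -/
abbrev H2 : Type := Lp ℂ 2 (volume : Measure (ℝ × ℝ))

/-! ### Product vectors and product operators -/

theorem memLp_tensor (f g : H1) :
    MemLp (fun q : ℝ × ℝ => f q.1 * g q.2) 2 (volume : Measure (ℝ × ℝ)) := by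
  have hf : AEStronglyMeasurable (fun q : ℝ × ℝ => f q.1) (volume : Measure (ℝ × ℝ)) :=
    (Lp.aestronglyMeasurable f).comp_fst
  have hg : AEStronglyMeasurable (fun q : ℝ × ℝ => g q.2) (volume : Measure (ℝ × ℝ)) :=
    (Lp.aestronglyMeasurable g).comp_snd
  refine (memLp_two_iff_integrable_sq_norm (hf.mul hg)).2 ?_
  have h := Integrable.mul_prod
    ((memLp_two_iff_integrable_sq_norm (Lp.aestronglyMeasurable f)).1 (Lp.memLp f))
    ((memLp_two_iff_integrable_sq_norm (Lp.aestronglyMeasurable g)).1 (Lp.memLp g))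
  simp only [Pi.mul_apply, norm_mul, mul_pow]
  exact h

/-- The product vector `f ⊗ g`, i.e. `(y, z) ↦ f y * g z`. -/
def tensor (f g : H1) : H2 := (memLp_tensor f g).toLp _

/-- `O = O_B ⊗ O_C`. Product vectors span a dense subspace, so this determines the bounded
operator `O` from `O_B` and `O_C`. -/
def IsTensorProduct (O : H2 →L[ℂ] H2) (OB OC : H1 →L[ℂ] H1) : Prop :=
  ∀ f g : H1, O (tensor f g) = tensor (OB f) (OC g)

/-! ### Position and momentum -/

/-- The position operator `(x̂ f)(x) = x f(x)` on its maximal domain. -/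
def position : H1 →ₗ.[ℂ] H1 where
  domain :=
    { carrier := {f | MemLp (fun x : ℝ => (x : ℂ) * f x) 2 volume}
      add_mem' := fun {f g} hf hg => by
        refine (MemLp.add hf hg).ae_eq ?_
        filter_upwards [Lp.coeFn_add f g] with x hx
        rw [hx]
        exact (mul_add _ _ _).symm
      zero_mem' := by
        refine (MemLp.zero : MemLp (0 : ℝ → ℂ) 2 volume).ae_eq ?_
        filter_upwards [Lp.coeFn_zero ℂ 2 (volume : Measure ℝ)] with x hx
        rw [hx, Pi.zero_apply, mul_zero]
      smul_mem' := fun c f hf => by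
        refine (MemLp.const_smul hf c).ae_eq ?_
        filter_upwards [Lp.coeFn_smul c f] with x hx
        simp [hx, mul_left_comm] }
  toFun :=
    { toFun := fun f => MemLp.toLp (fun x : ℝ => (x : ℂ) * (f : H1) x) f.2
      map_add' := fun f g => by
        rw [← MemLp.toLp_add]
        refine MemLp.toLp_congr _ _ ?_
        filter_upwards [Lp.coeFn_add (f : H1) (g : H1)] with x hx
        rw [Submodule.coe_add, hx, Pi.add_apply, mul_add]
        rfl
      map_smul' := fun c f => by
        rw [RingHom.id_apply, ← MemLp.toLp_const_smul]
        refine MemLp.toLp_congr _ _ ?_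
        filter_upwards [Lp.coeFn_smul c (f : H1)] with x hx
        simp [hx, mul_left_comm] }

/-- `L²(ℝ)` inside the tempered distributions. -/
def toDist : H1 →ₗ[ℂ] 𝓢'(ℝ, ℂ) := (Lp.toTemperedDistributionCLM ℂ volume 2).toLinearMap

theorem toDist_injective : Function.Injective toDist :=
  LinearMap.ker_eq_bot.1 Lp.ker_toTemperedDistributionCLM_eq_bot

/-- The distributional derivative of a function in `L²(ℝ)`. -/
def distDeriv : H1 →ₗ[ℂ] 𝓢'(ℝ, ℂ) := (TemperedDistribution.derivCLM ℂ).toLinearMap ∘ₗ toDist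

/-- The Sobolev space `H¹(ℝ)`: the `f ∈ L²(ℝ)` whose distributional derivative is in `L²(ℝ)`. -/
def sobolev : Submodule ℂ H1 := (LinearMap.range toDist).comap distDeriv

/-- The derivative `H¹(ℝ) → L²(ℝ)`. -/
def weakDeriv : sobolev →ₗ[ℂ] H1 :=
  (LinearEquiv.ofInjective toDist toDist_injective).symm.toLinearMap ∘ₗ
    (distDeriv ∘ₗ sobolev.subtype).codRestrict (LinearMap.range toDist) fun f => f.2

theorem toDist_weakDeriv (f : sobolev) : toDist (weakDeriv f) = distDeriv (f : H1) :=
  congrArg Subtype.val (LinearEquiv.apply_symm_apply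
    (LinearEquiv.ofInjective toDist toDist_injective) ⟨distDeriv (f : H1), f.2⟩)

/-- The momentum operator `p̂ f = -i f'` (with `ħ = 1`) on the domain `H¹(ℝ)`. -/
def momentum : H1 →ₗ.[ℂ] H1 where
  domain := sobolev
  toFun := (-Complex.I) • weakDeriv

/-- `[T, O] = 0` for an unbounded operator `T` and a bounded operator `O`: `O` preserves the domain
of `T`, and `T O f - O T f = 0` for all `f` in it. -/
def CommutatorZero (T : H1 →ₗ.[ℂ] H1) (O : H1 →L[ℂ] H1) : Prop :=
  ∀ f : T.domain, ∃ h : O f ∈ T.domain, T ⟨O f, h⟩ - O (T f) = 0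

/-- `{T, O} = 0` for an unbounded operator `T` and a bounded operator `O`: `O` preserves the domain
of `T`, and `T O f + O T f = 0` for all `f` in it. -/
def AnticommutatorZero (T : H1 →ₗ.[ℂ] H1) (O : H1 →L[ℂ] H1) : Prop :=
  ∀ f : T.domain, ∃ h : O f ∈ T.domain, T ⟨O f, h⟩ + O (T f) = 0

/-! ### The change of quantum reference frame -/

theorem measurePreserving_shear :
    MeasurePreserving (fun q : ℝ × ℝ => (q.1 + q.2, q.2)) volume volume :=
  measurePreserving_add_prod (volume : Measure ℝ) (volume : Measure ℝ)

theorem measurePreserving_paritySwap :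
    MeasurePreserving (fun q : ℝ × ℝ => (q.2, -q.1)) volume volume :=
  (((MeasurePreserving.id (volume : Measure ℝ)).prod
    (Measure.measurePreserving_neg (volume : Measure ℝ)))).comp Measure.measurePreserving_swap

theorem memLp_phase (P : ℝ) :
    MemLp (fun q : ℝ × ℝ => Complex.exp (-(Complex.I * q.2 * P))) ∞
      (volume : Measure (ℝ × ℝ)) := by
  refine memLp_top_of_bound (by fun_prop) 1 (Filter.Eventually.of_forall fun q => ?_)
  rw [Complex.norm_exp]
  simp

/-- The controlled translation `exp (i x̂_C (p̂_B - P))`. Since `exp (i z p̂)` is the translation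
`f ↦ f (· + z)`, it maps `ψ` to `(y, z) ↦ exp (-i z P) * ψ (y + z, z)`. -/
def expXP (P : ℝ) : H2 →L[ℂ] H2 :=
  (ContinuousLinearMap.mul ℂ ℂ).holderL volume ∞ 2 2 ((memLp_phase P).toLp _) ∘L
    (Lp.compMeasurePreservingₗᵢ ℂ _ measurePreserving_shear).toContinuousLinearMap

theorem expXP_apply (P : ℝ) (ψ : H2) :
    ∀ᵐ q : ℝ × ℝ, expXP P ψ q = Complex.exp (-(Complex.I * q.2 * P)) * ψ (q.1 + q.2, q.2) := by
  let φ : H2 := Lp.compMeasurePreservingₗᵢ ℂ _ measurePreserving_shear ψ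
  have hφ := Lp.coeFn_compMeasurePreserving ψ measurePreserving_shear
  have h := (ContinuousLinearMap.mul ℂ ℂ).coeFn_holder (r := 2) ((memLp_phase P).toLp _) φ
  filter_upwards [h, hφ, (memLp_phase P).coeFn_toLp] with q h₁ h₂ h₃
  exact h₁.trans (by rw [h₃]; exact congrArg _ h₂)

/-- The parity swap `∫ dx |-x⟩_A ⟨x|_C` from the description relative to `A` to the one relative
to `C`; it maps `ψ` to `(x_A, x_B) ↦ ψ (x_B, -x_A)`. -/
def paritySwap : H2 →L[ℂ] H2 :=
  (Lp.compMeasurePreservingₗᵢ ℂ _ measurePreserving_paritySwap).toContinuousLinearMap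

/-- The QRF transformation `S^P = 𝒫_{AC} exp (i x̂_C (p̂_B - P))` from `A` to `C` in the sector of
total momentum `P`. -/
def transformation (P : ℝ) : H2 →L[ℂ] H2 := paritySwap ∘L expXP P

/-- `O` is invariant under the QRF transformation in the sector `P`, i.e. up to a parity swap:
`S^P O (S^P)† = 𝒫_{AC} O 𝒫_{AC}†`. -/
def Invariant (P : ℝ) (O : H2 →L[ℂ] H2) : Prop :=
  transformation P ∘L O ∘L (transformation P).adjoint = paritySwap ∘L O ∘L paritySwap.adjoint

end QRF

end

/-!
Write `T_z` for the translation `f ↦ f (· + z)`. Up to the parity swap, invariance of `O` in the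
sector `P` says that `O` commutes with the unitary `exp (i x̂_C (p̂_B - P))`.

In the sector `0`, matrix elements in the first factor show that `O_C` intertwines multiplication
by `z ↦ ⟨f, T_z O_B g⟩` with multiplication by `z ↦ ⟨O_B† f, T_z g⟩`. Hence the kernel of `O_C` is
supported on `R = {(z, z') | T_z O_B = O_B T_{z'}}`. This is a closed subgroup of `ℝ²`, and it is
symmetric because `O_B` is proportional to its adjoint. A symmetric closed subgroup contains the
diagonal, contains the antidiagonal, or is countable. A countable `R` would force `O_C = 0`. In the
other cases `R` is exactly the line `z = ε z'` with `ε = ±1`, because no non-zero function in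
`L²(ℝ)` is periodic. Support on this line gives `h(x̂) O_C = O_C h(ε x̂)` for every measurable `h`,
and differentiating `T_z O_B = O_B T_{ε z}` gives `p̂ O_B = ε O_B p̂`.

Given invariance in the sector `0`, invariance in the sector `P` means that `O_C` commutes with the
phase `exp (-i P x̂)`; for `P ≠ 0` this holds when `ε = 1` and fails when `ε = -1`.
-/

noncomputable section

namespace QRF

open scoped Topology

section MultiplicationOperators

variable {α : Type*} [MeasurableSpace α] {μ : Measure α}

/-- Multiplication by an essentially bounded function, as an operator on `L²`. -/
def mulOp {h : α → ℂ} (hh : MemLp h ∞ μ) : Lp ℂ 2 μ →L[ℂ] Lp ℂ 2 μ :=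
  (ContinuousLinearMap.mul ℂ ℂ).holderL μ ∞ 2 2 (hh.toLp h)

theorem mulOp_apply {h : α → ℂ} (hh : MemLp h ∞ μ) (f : Lp ℂ 2 μ) :
    ∀ᵐ x ∂μ, mulOp hh f x = h x * f x := by
  have hmul := (ContinuousLinearMap.mul ℂ ℂ).coeFn_holder (r := 2) (hh.toLp h) f
  filter_upwards [hmul, hh.coeFn_toLp] with x hmul hh
  exact hmul.trans (by rw [hh]; rfl)

theorem eq_mulOp_of_ae {h : α → ℂ} (hh : MemLp h ∞ μ) {f f' : Lp ℂ 2 μ}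
    (hf : ∀ᵐ x ∂μ, f' x = h x * f x) : f' = mulOp hh f := by
  refine Lp.ext ?_
  filter_upwards [hf, mulOp_apply hh f] with x hx hx'
  rw [hx, hx']

theorem inner_mulOp {h : α → ℂ} (hh : MemLp h ∞ μ) (f g : Lp ℂ 2 μ) :
    inner ℂ f (mulOp hh g) = ∫ x, h x * inner ℂ (f x) (g x) ∂μ := by
  rw [L2.inner_def]
  refine integral_congr_ae ?_
  filter_upwards [mulOp_apply hh g] with x hx
  rw [hx, ← smul_eq_mul, inner_smul_right]

theorem exists_ae_eq_mul_norm_le {u : α → ℂ} (hu : AEStronglyMeasurable u μ) {f : Lp ℂ 2 μ} {C : ℝ}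
    (h : ∀ᵐ x ∂μ, f x ≠ 0 → ‖u x‖ ≤ C) :
    ∃ f' : Lp ℂ 2 μ, (∀ᵐ x ∂μ, f' x = u x * f x) ∧ ‖f'‖ ≤ C * ‖f‖ := by
  have hbound : ∀ᵐ x ∂μ, ‖u x * f x‖ ≤ C * ‖f x‖ := by
    filter_upwards [h] with x hx
    by_cases hfx : f x = 0
    · simp [hfx]
    · rw [norm_mul]
      exact mul_le_mul_of_nonneg_right (hx hfx) (norm_nonneg _)
  have hmem : MemLp (fun x => u x * f x) 2 μ :=
    (Lp.memLp f).of_le_mul (hu.mul (Lp.aestronglyMeasurable f)) hbound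
  refine ⟨hmem.toLp _, hmem.coeFn_toLp, Lp.norm_le_mul_norm_of_ae_le_mul ?_⟩
  filter_upwards [hmem.coeFn_toLp, hbound] with x hx hbx
  rwa [hx]

/-- Restriction of an `L²` function to a measurable set, extended by zero. -/
def cutoff {E : Set α} (hE : MeasurableSet E) : Lp ℂ 2 μ →L[ℂ] Lp ℂ 2 μ :=
  mulOp ((memLp_top_const (1 : ℂ)).indicator hE)

theorem cutoff_apply {E : Set α} (hE : MeasurableSet E) (f : Lp ℂ 2 μ) :
    ∀ᵐ x ∂μ, cutoff hE f x = E.indicator f x := by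
  filter_upwards [mulOp_apply ((memLp_top_const (1 : ℂ)).indicator hE) f] with x hx
  rw [cutoff, hx]
  by_cases hxE : x ∈ E <;> simp [hxE]

theorem norm_cutoff_apply_le {E : Set α} (hE : MeasurableSet E) (f : Lp ℂ 2 μ) :
    ‖cutoff hE f‖ ≤ ‖f‖ := by
  refine Lp.norm_le_norm_of_ae_le ?_
  filter_upwards [cutoff_apply hE f] with x hx
  rw [hx]
  exact norm_indicator_le_norm_self _ _

/-- `f` vanishes almost everywhere on the set `E`. -/
def VanishesOn (f : Lp ℂ 2 μ) (E : Set α) : Prop :=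
  ∀ᵐ x ∂μ, x ∈ E → f x = 0

theorem VanishesOn.mono {f : Lp ℂ 2 μ} {E E' : Set α} (hf : VanishesOn f E) (h : E' ⊆ E) :
    VanishesOn f E' := by
  filter_upwards [hf] with x hx hxE using hx (h hxE)

theorem vanishesOn_biUnion {ι : Type*} {t : Set ι} (ht : t.Countable) {E : ι → Set α}
    {f : Lp ℂ 2 μ} (hf : ∀ i ∈ t, VanishesOn f (E i)) : VanishesOn f (⋃ i ∈ t, E i) := by
  filter_upwards [(ae_ball_iff ht).2 hf] with x hx hxE
  obtain ⟨i, hi, hxi⟩ := Set.mem_iUnion₂.1 hxE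
  exact hx i hi hxi

theorem vanishesOn_cutoff {E : Set α} (hE : MeasurableSet E) (f : Lp ℂ 2 μ) :
    VanishesOn (cutoff hE f) Eᶜ := by
  filter_upwards [cutoff_apply hE f] with x hx hxE
  rw [hx, Set.indicator_of_notMem hxE]

theorem cutoff_eq_self_iff {E : Set α} (hE : MeasurableSet E) {f : Lp ℂ 2 μ} :
    cutoff hE f = f ↔ VanishesOn f Eᶜ := by
  refine ⟨fun h => h ▸ vanishesOn_cutoff hE f, fun hf => Lp.ext ?_⟩
  filter_upwards [cutoff_apply hE f, hf] with x hx hfx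
  by_cases hxE : x ∈ E
  · rw [hx, Set.indicator_of_mem hxE]
  · rw [hx, Set.indicator_of_notMem hxE, hfx hxE]

theorem cutoff_eq_zero_iff {E : Set α} (hE : MeasurableSet E) {f : Lp ℂ 2 μ} :
    cutoff hE f = 0 ↔ VanishesOn f E := by
  rw [Lp.eq_zero_iff_ae_eq_zero]
  refine Filter.eventually_congr ?_
  filter_upwards [cutoff_apply hE f] with x hx
  rw [hx, Pi.zero_apply, Set.indicator_apply_eq_zero]

theorem vanishesOn_univ_iff {f : Lp ℂ 2 μ} : VanishesOn f Set.univ ↔ f = 0 := by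
  simp only [Lp.eq_zero_iff_ae_eq_zero, VanishesOn, Set.mem_univ, true_imp_iff]
  rfl

theorem inner_cutoff_self {E : Set α} (hE : MeasurableSet E) (f : Lp ℂ 2 μ) :
    inner ℂ (cutoff hE f) f = inner ℂ (cutoff hE f) (cutoff hE f) := by
  rw [L2.inner_def, L2.inner_def]
  refine integral_congr_ae ?_
  filter_upwards [cutoff_apply hE f] with x hx
  by_cases hxE : x ∈ E <;> simp [hx, hxE]

theorem vanishesOn_of_forall_isCompact [TopologicalSpace α] [μ.InnerRegular] {f : Lp ℂ 2 μ}
    {E : Set α} (hE : MeasurableSet E) (hf : ∀ C ⊆ E, IsCompact C → VanishesOn f C) :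
    VanishesOn f E := by
  have hmeas : MeasurableSet (E ∩ f ⁻¹' {0}ᶜ) :=
    hE.inter ((Lp.stronglyMeasurable f).measurable (measurableSet_singleton 0).compl)
  suffices hnull : μ (E ∩ f ⁻¹' {0}ᶜ) = 0 by
    filter_upwards [measure_eq_zero_iff_ae_notMem.1 hnull] with x hx hxE
    by_contra hfx
    exact hx ⟨hxE, hfx⟩
  by_contra hpos
  obtain ⟨C, hCsub, hC, hCpos⟩ := hmeas.exists_lt_isCompact (pos_iff_ne_zero.2 hpos)
  refine hCpos.ne' (measure_eq_zero_iff_ae_notMem.2 ?_)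
  filter_upwards [hf C (hCsub.trans Set.inter_subset_left) hC] with x hx hxC
  exact (hCsub hxC).2 (hx hxC)

end MultiplicationOperators

section ZeroBlocks

variable {α β : Type*} [MeasurableSpace α] [MeasurableSpace β] {μ : Measure α} {ν : Measure β}
  {K : Lp ℂ 2 ν →L[ℂ] Lp ℂ 2 μ}

/-- The block of `K` from `L²(F)` to `L²(E)` is zero. Informally, the integral kernel of `K`
vanishes on `E ×ˢ F`. -/
def BlockZero (K : Lp ℂ 2 ν →L[ℂ] Lp ℂ 2 μ) (E : Set α) (F : Set β) : Prop :=
  ∀ g, VanishesOn g Fᶜ → VanishesOn (K g) E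

theorem BlockZero.mono {E E' : Set α} {F F' : Set β} (h : BlockZero K E F) (hE : E' ⊆ E)
    (hF : F' ⊆ F) : BlockZero K E' F' :=
  fun g hg => (h g (hg.mono (Set.compl_subset_compl.2 hF))).mono hE

theorem BlockZero.union_right {E : Set α} {F F' : Set β} (hF : MeasurableSet F)
    (h : BlockZero K E F) (h' : BlockZero K E F') : BlockZero K E (F ∪ F') := by
  intro g hg
  have hrest : VanishesOn (g - cutoff hF g) F'ᶜ := by
    filter_upwards [hg, cutoff_apply hF g, Lp.coeFn_sub g (cutoff hF g)] with y hgy hcut hsub hy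
    rw [hsub, Pi.sub_apply, hcut]
    by_cases hyF : y ∈ F
    · rw [Set.indicator_of_mem hyF, sub_self]
    · rw [Set.indicator_of_notMem hyF, sub_zero, hgy (by simp_all)]
  filter_upwards [h _ (vanishesOn_cutoff hF g), h' _ hrest,
    Lp.coeFn_add (K (cutoff hF g)) (K (g - cutoff hF g))] with x hin hout hadd hx
  rw [← map_add, add_sub_cancel] at hadd
  rw [hadd, Pi.add_apply, hin hx, hout hx, add_zero]

theorem BlockZero.adjoint {E : Set α} {F : Set β} (hF : MeasurableSet F) (h : BlockZero K E F) :
    BlockZero K.adjoint F E := by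
  intro f hf
  have hKf := h _ (vanishesOn_cutoff hF (K.adjoint f))
  have horth : inner ℂ (K (cutoff hF (K.adjoint f))) f = 0 := by
    rw [L2.inner_def]
    refine integral_eq_zero_of_ae ?_
    filter_upwards [hf, hKf] with x hfx hKx
    by_cases hx : x ∈ E
    · simp [hKx hx]
    · simp [hfx hx]
  rw [← cutoff_eq_zero_iff hF, ← inner_self_eq_zero (𝕜 := ℂ), ← inner_cutoff_self,
    ContinuousLinearMap.adjoint_inner_right, horth]

theorem eq_zero_of_blockZero_univ {E : Set α} (hE : ∀ᵐ x ∂μ, x ∈ E)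
    (h : BlockZero K E Set.univ) : K = 0 := by
  ext1 g
  refine vanishesOn_univ_iff.1 ?_
  have hg : VanishesOn g Set.univᶜ := Filter.Eventually.of_forall fun y hy => (hy trivial).elim
  filter_upwards [h g hg, hE] with x hx hxE _ using hx hxE

/-- The block of `K` from `L²(F)` to `L²(E)`, extended by zero. -/
def block (K : Lp ℂ 2 ν →L[ℂ] Lp ℂ 2 μ) {E : Set α} {F : Set β} (hE : MeasurableSet E)
    (hF : MeasurableSet F) : Lp ℂ 2 ν →L[ℂ] Lp ℂ 2 μ :=
  cutoff hE ∘L K ∘L cutoff hF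

theorem blockZero_of_block_eq_zero {E : Set α} {F : Set β} (hE : MeasurableSet E)
    (hF : MeasurableSet F) (h : block K hE hF = 0) : BlockZero K E F := by
  intro g hg
  have hKg : block K hE hF g = 0 := by rw [h, zero_apply]
  rwa [block, ContinuousLinearMap.comp_apply, ContinuousLinearMap.comp_apply,
    (cutoff_eq_self_iff hF).2 hg, cutoff_eq_zero_iff] at hKg

theorem blockZero_empty_right (E : Set α) : BlockZero K E ∅ := by
  intro g hg
  have hg₀ : g = 0 := vanishesOn_univ_iff.1 (by rwa [Set.compl_empty] at hg)
  rw [hg₀, map_zero]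
  exact (vanishesOn_univ_iff.2 rfl).mono (Set.subset_univ E)

theorem exists_nhds_blockZero_of_isCompact [TopologicalSpace α] [TopologicalSpace β]
    [OpensMeasurableSpace β] {x : α} {F : Set β} (hF : IsCompact F)
    (h : ∀ y ∈ F, ∃ U ∈ 𝓝 x, ∃ V ∈ 𝓝 y, BlockZero K U V) : ∃ U ∈ 𝓝 x, BlockZero K U F := by
  suffices ∃ U ∈ 𝓝 x, ∃ V, IsOpen V ∧ F ⊆ V ∧ BlockZero K U V by
    obtain ⟨U, hU, V, -, hFV, hUV⟩ := this
    exact ⟨U, hU, hUV.mono subset_rfl hFV⟩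
  refine hF.induction_on (p := fun S => ∃ U ∈ 𝓝 x, ∃ V, IsOpen V ∧ S ⊆ V ∧ BlockZero K U V)
    ?_ ?_ ?_ ?_
  · exact ⟨Set.univ, Filter.univ_mem, ∅, isOpen_empty, subset_rfl, blockZero_empty_right _⟩
  · rintro S T hST ⟨U, hU, V, hV, hTV, hUV⟩
    exact ⟨U, hU, V, hV, hST.trans hTV, hUV⟩
  · rintro S T ⟨U, hU, V, hV, hSV, hUV⟩ ⟨U', hU', V', hV', hTV', hUV'⟩
    exact ⟨U ∩ U', Filter.inter_mem hU hU', V ∪ V', hV.union hV', Set.union_subset_union hSV hTV',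
      (hUV.mono Set.inter_subset_left subset_rfl).union_right hV.measurableSet
        (hUV'.mono Set.inter_subset_right subset_rfl)⟩
  · intro y hy
    obtain ⟨U, hU, V, hV, hUV⟩ := h y hy
    obtain ⟨W, hWV, hW, hyW⟩ := mem_nhds_iff.1 hV
    exact ⟨W, mem_nhdsWithin_of_mem_nhds (hW.mem_nhds hyW), U, hU, W, hW, subset_rfl,
      hUV.mono subset_rfl hWV⟩

theorem blockZero_of_isCompact [TopologicalSpace α] [SecondCountableTopology α]
    [TopologicalSpace β] [OpensMeasurableSpace β] {E : Set α} {F : Set β} (hF : IsCompact F)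
    (h : ∀ x ∈ E, ∀ y ∈ F, ∃ U ∈ 𝓝 x, ∃ V ∈ 𝓝 y, BlockZero K U V) : BlockZero K E F := by
  choose! U hU hUF using fun x hx => exists_nhds_blockZero_of_isCompact hF (h x hx)
  obtain ⟨t, htE, ht, hcover⟩ := TopologicalSpace.countable_cover_nhdsWithin
    fun x hx => mem_nhdsWithin_of_mem_nhds (hU x hx)
  exact fun g hg => (vanishesOn_biUnion ht fun x hx => hUF x (htE hx) g hg).mono hcover

theorem blockZero_of_locally [TopologicalSpace α] [SecondCountableTopology α]
    [TopologicalSpace β] [T2Space β] [OpensMeasurableSpace β] [ν.InnerRegular]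
    {E : Set α} {F : Set β} (hE : MeasurableSet E) (hF : MeasurableSet F)
    (h : ∀ x ∈ E, ∀ y ∈ F, ∃ U ∈ 𝓝 x, ∃ V ∈ 𝓝 y, BlockZero K U V) : BlockZero K E F := by
  have hadj : BlockZero K.adjoint F E := fun f hf => by
    refine vanishesOn_of_forall_isCompact hF fun C hCF hC => ?_
    have hEC : BlockZero K E C := blockZero_of_isCompact hC fun x hx y hy => h x hx y (hCF hy)
    exact hEC.adjoint hC.measurableSet f hf
  simpa using hadj.adjoint hE

end ZeroBlocks

section Intertwining

variable {α β : Type*} [MeasurableSpace α] [MeasurableSpace β] {μ : Measure α} {ν : Measure β}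
  {K : Lp ℂ 2 ν →L[ℂ] Lp ℂ 2 μ}

/-- `K` intertwines multiplication by `k` with multiplication by `h`: `K (k g) = h (K g)`
whenever `k g` is square integrable. The functions `h` and `k` need not be bounded. -/
def IntertwinesMul (K : Lp ℂ 2 ν →L[ℂ] Lp ℂ 2 μ) (h : α → ℂ) (k : β → ℂ) : Prop :=
  ∀ ⦃g g' : Lp ℂ 2 ν⦄, (∀ᵐ y ∂ν, g' y = k y * g y) → ∀ᵐ x ∂μ, K g' x = h x * K g x

theorem intertwinesMul_iff {h : α → ℂ} {k : β → ℂ} (hh : MemLp h ∞ μ) (hk : MemLp k ∞ ν) :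
    IntertwinesMul K h k ↔ K ∘L mulOp hk = mulOp hh ∘L K := by
  refine ⟨fun hK => ?_, fun hK g g' hg => ?_⟩
  · ext1 g
    exact eq_mulOp_of_ae hh (hK (mulOp_apply hk g))
  · rw [eq_mulOp_of_ae hk hg, ← ContinuousLinearMap.comp_apply, hK]
    exact mulOp_apply hh (K g)

theorem eq_zero_of_forall_mul {k : β → ℂ} (hk : Measurable k)
    (hK : ∀ g g' : Lp ℂ 2 ν, (∀ᵐ y ∂ν, g' y = k y * g y) → K g = 0) : K = 0 := by
  have hblock (n : ℕ) : BlockZero K Set.univ {y | ‖k y‖ ≤ n} := fun g hg => by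
    have hbound : ∀ᵐ y ∂ν, g y ≠ 0 → ‖k y‖ ≤ n := by
      filter_upwards [hg] with y hy hgy using not_not.1 (mt hy hgy)
    obtain ⟨g', hg', -⟩ := exists_ae_eq_mul_norm_le hk.aestronglyMeasurable hbound
    exact vanishesOn_univ_iff.2 (hK g g' hg')
  refine ContinuousLinearMap.adjoint.injective ((ContinuousLinearMap.ext fun f => ?_).trans
    (map_zero _).symm)
  have hvan (n : ℕ) : VanishesOn (K.adjoint f) {y | ‖k y‖ ≤ n} :=
    (hblock n).adjoint (measurableSet_le hk.norm measurable_const) f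
      (Filter.Eventually.of_forall fun x hx => (hx trivial).elim)
  refine vanishesOn_univ_iff.1 ?_
  filter_upwards [ae_all_iff.2 hvan] with y hy _
  exact (exists_nat_ge ‖k y‖).elim hy

theorem IntertwinesMul.eq_zero_of_ae_ne {h h' : α → ℂ} {k : β → ℂ} (hK : IntertwinesMul K h k)
    (hK' : IntertwinesMul K h' k) (hk : Measurable k) (hne : ∀ᵐ x ∂μ, h x ≠ h' x) : K = 0 := by
  refine eq_zero_of_forall_mul hk fun g g' hg => vanishesOn_univ_iff.1 ?_
  filter_upwards [hK hg, hK' hg, hne] with x hx hx' hne _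
  exact (mul_eq_mul_right_iff.1 (hx.symm.trans hx')).resolve_left hne

theorem IntertwinesMul.sub_const {h : α → ℂ} {k : β → ℂ} (hK : IntertwinesMul K h k) (c : ℂ) :
    IntertwinesMul K (fun x => h x - c) (fun y => k y - c) := by
  intro g g' hg
  have hadd : ∀ᵐ y ∂ν, (g' + c • g) y = k y * g y := by
    filter_upwards [hg, Lp.coeFn_add g' (c • g), Lp.coeFn_smul c g] with y hy hadd hsmul
    rw [hadd, Pi.add_apply, hsmul, Pi.smul_apply, hy, smul_eq_mul]
    ring
  have hK' := hK hadd
  rw [map_add, map_smul] at hK'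
  filter_upwards [hK', Lp.coeFn_add (K g') (c • K g), Lp.coeFn_smul c (K g)] with x hx hadd hsmul
  rw [hadd, Pi.add_apply, hsmul, Pi.smul_apply, smul_eq_mul] at hx
  linear_combination hx

-- Up to errors of relative size `δ`, multiplication by `h` acts as `a` on `E` and multiplication
-- by `k` acts as `b` on `F`.
theorem IntertwinesMul.exists_smul_block_eq {h : α → ℂ} {k : β → ℂ} (hh : Measurable h)
    (hk : Measurable k) (hK : IntertwinesMul K h k) {a b : ℂ} {δ : ℝ} {E : Set α} {F : Set β}
    (hE : MeasurableSet E) (hF : MeasurableSet F) (ha : ∀ x ∈ E, ‖h x - a‖ ≤ δ)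
    (hb : ∀ y ∈ F, ‖k y - b‖ ≤ δ) (g : Lp ℂ 2 ν) :
    ∃ g' f', ‖g'‖ ≤ δ * ‖cutoff hF g‖ ∧ ‖f'‖ ≤ δ * ‖block K hE hF g‖ ∧
      (a - b) • block K hE hF g = block K hE hF g' - f' := by
  obtain ⟨g', hg', hg'norm⟩ : ∃ g' : Lp ℂ 2 ν,
      (∀ᵐ y ∂ν, g' y = (k y - b) * cutoff hF g y) ∧ ‖g'‖ ≤ δ * ‖cutoff hF g‖ := by
    refine exists_ae_eq_mul_norm_le (hk.sub_const b).aestronglyMeasurable ?_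
    filter_upwards [vanishesOn_cutoff hF g] with y hy hne
    exact hb y (not_not.1 (mt hy hne))
  obtain ⟨f', hf', hf'norm⟩ : ∃ f' : Lp ℂ 2 μ,
      (∀ᵐ x ∂μ, f' x = (h x - a) * block K hE hF g x) ∧ ‖f'‖ ≤ δ * ‖block K hE hF g‖ := by
    refine exists_ae_eq_mul_norm_le (hh.sub_const a).aestronglyMeasurable ?_
    filter_upwards [vanishesOn_cutoff hE (K (cutoff hF g))] with x hx hne
    exact ha x (not_not.1 (mt hx hne))
  have hcut : cutoff hF g' = g' := by
    rw [cutoff_eq_self_iff]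
    filter_upwards [hg', vanishesOn_cutoff hF g] with y hy hvan hyF
    rw [hy, hvan hyF, mul_zero]
  refine ⟨g', f', hg'norm, hf'norm, Lp.ext ?_⟩
  filter_upwards [hK.sub_const b hg', hf', cutoff_apply hE (K (cutoff hF g)),
    cutoff_apply hE (K g'), Lp.coeFn_sub (block K hE hF g') f',
    Lp.coeFn_smul (a - b) (block K hE hF g)] with x hKx hf'x hKg hKg' hsub hsmul
  rw [hsub, hsmul, Pi.sub_apply, Pi.smul_apply, hf'x, smul_eq_mul]
  simp only [block, ContinuousLinearMap.comp_apply]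
  rw [hKg, hcut, hKg']
  by_cases hx : x ∈ E
  · rw [Set.indicator_of_mem hx, Set.indicator_of_mem hx, hKx]
    ring
  · simp [Set.indicator_of_notMem hx]

theorem IntertwinesMul.blockZero_of_norm_sub_le {h : α → ℂ} {k : β → ℂ} (hh : Measurable h)
    (hk : Measurable k) (hK : IntertwinesMul K h k) {a b : ℂ} {δ : ℝ} (hδ : 0 ≤ δ)
    (hab : 2 * δ < ‖a - b‖) : BlockZero K {x | ‖h x - a‖ ≤ δ} {y | ‖k y - b‖ ≤ δ} := by
  have hE : MeasurableSet {x | ‖h x - a‖ ≤ δ} :=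
    measurableSet_le (hh.sub_const a).norm measurable_const
  have hF : MeasurableSet {y | ‖k y - b‖ ≤ δ} :=
    measurableSet_le (hk.sub_const b).norm measurable_const
  refine blockZero_of_block_eq_zero hE hF (norm_le_zero_iff.1 ?_)
  have hle : ‖(a - b) • block K hE hF‖ ≤ 2 * δ * ‖block K hE hF‖ := by
    refine ContinuousLinearMap.opNorm_le_bound _ (by positivity) fun g => ?_
    obtain ⟨g', f', hg', hf', heq⟩ :=
      hK.exists_smul_block_eq hh hk hE hF (fun _ hx => hx) (fun _ hy => hy) g
    calc ‖((a - b) • block K hE hF) g‖ = ‖block K hE hF g' - f'‖ := by rw [← heq]; rfl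
      _ ≤ ‖block K hE hF g'‖ + ‖f'‖ := norm_sub_le _ _
      _ ≤ ‖block K hE hF‖ * (δ * ‖g‖) + δ * (‖block K hE hF‖ * ‖g‖) := by
        have hcut := norm_cutoff_apply_le hF g
        have hblock := (block K hE hF).le_opNorm g
        refine add_le_add ((block K hE hF).le_opNorm_of_le (hg'.trans ?_)) (hf'.trans ?_) <;> gcongr
      _ = 2 * δ * ‖block K hE hF‖ * ‖g‖ := by ring
  rw [norm_smul] at hle
  nlinarith

theorem blockZero_of_forall_exists_intertwinesMul [TopologicalSpace α] [SecondCountableTopology α]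
    [OpensMeasurableSpace α] [TopologicalSpace β] [T2Space β] [OpensMeasurableSpace β]
    [ν.InnerRegular] {E : Set α} {F : Set β} (hE : MeasurableSet E) (hF : MeasurableSet F)
    (hK : ∀ x ∈ E, ∀ y ∈ F, ∃ h k, Continuous h ∧ Continuous k ∧ IntertwinesMul K h k ∧
      h x ≠ k y) : BlockZero K E F := by
  refine blockZero_of_locally hE hF fun x hx y hy => ?_
  obtain ⟨h, k, hh, hk, hK, hne⟩ := hK x hx y hy
  have hpos : 0 < ‖h x - k y‖ := norm_pos_iff.2 (sub_ne_zero.2 hne)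
  refine ⟨_, ?_, _, ?_, hK.blockZero_of_norm_sub_le hh.measurable hk.measurable
    (a := h x) (b := k y) (δ := ‖h x - k y‖ / 3) (by positivity) (by linarith)⟩
  · exact ((hh.sub continuous_const).norm.tendsto x).eventually_le_const
      (by simpa using sub_ne_zero.2 hne)
  · exact ((hk.sub continuous_const).norm.tendsto y).eventually_le_const
      (by simpa using sub_ne_zero.2 hne)

theorem exists_measurable_nat_norm_sub_le {h : α → ℂ} (hh : Measurable h) {δ : ℝ} (hδ : 0 < δ) :
    ∃ (N : α → ℕ) (c : ℕ → ℂ), Measurable N ∧ ∀ x, ‖h x - c (N x)‖ ≤ δ := by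
  classical
  have hex (x : α) : ∃ n, ‖h x - TopologicalSpace.denseSeq ℂ n‖ < δ := by
    simpa only [dist_eq_norm] using
      (TopologicalSpace.denseRange_denseSeq ℂ).exists_dist_lt (h x) hδ
  refine ⟨fun x => Nat.find (hex x), TopologicalSpace.denseSeq ℂ,
    measurable_find hex fun n => measurableSet_lt (hh.sub_const _).norm measurable_const,
    fun x => (Nat.find_spec (hex x)).le⟩

theorem intertwinesMul_comp_nat {τ : β → α} (hK : ∀ E, MeasurableSet E → BlockZero K E (τ ⁻¹' E)ᶜ)
    {N : α → ℕ} (hN : Measurable N) (c : ℕ → ℂ) :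
    IntertwinesMul K (fun x => c (N x)) (fun y => c (N (τ y))) := by
  intro g g' hg
  have hlevel (n : ℕ) : VanishesOn (K (g' - c n • g)) (N ⁻¹' {n}) := by
    refine hK _ (hN (measurableSet_singleton n)) _ ?_
    filter_upwards [hg, Lp.coeFn_sub g' (c n • g), Lp.coeFn_smul (c n) g] with y hy hsub hsmul hn
    rw [compl_compl] at hn
    rw [hsub, Pi.sub_apply, hsmul, Pi.smul_apply, hy, smul_eq_mul, show N (τ y) = n from hn,
      sub_self]
  filter_upwards [ae_all_iff.2 hlevel, ae_all_iff.2 fun n => Lp.coeFn_sub (K g') (c n • K g),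
    ae_all_iff.2 fun n => Lp.coeFn_smul (c n) (K g)] with x hx hsub hsmul
  have hx' := hx (N x) rfl
  rw [map_sub, map_smul, hsub, Pi.sub_apply, hsmul, Pi.smul_apply, smul_eq_mul] at hx'
  exact sub_eq_zero.1 hx'

theorem ae_eq_zero_of_forall_exists_norm_le {u : α → ℂ} {C : ℝ}
    (h : ∀ δ > 0, ∃ f : Lp ℂ 2 μ, u =ᵐ[μ] f ∧ ‖f‖ ≤ δ * C) : u =ᵐ[μ] 0 := by
  obtain ⟨f, hf, -⟩ := h 1 one_pos
  have hle (δ : ℝ) (hδ : 0 < δ) : ‖f‖ ≤ δ * C := by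
    obtain ⟨f', hf', hnorm⟩ := h δ hδ
    rwa [Lp.ext (hf.symm.trans hf')]
  have hlim : Filter.Tendsto (fun δ : ℝ => δ * C) (𝓝[>] 0) (𝓝 0) := by
    simpa using ((continuous_mul_const C).tendsto 0).mono_left nhdsWithin_le_nhds
  have hzero : ‖f‖ ≤ 0 := ge_of_tendsto hlim (by filter_upwards [self_mem_nhdsWithin] using hle)
  exact hf.trans (Lp.eq_zero_iff_ae_eq_zero.1 (norm_le_zero_iff.1 hzero))

theorem intertwinesMul_comp {τ : β → α} (hτ : Measurable τ)
    (hK : ∀ E, MeasurableSet E → BlockZero K E (τ ⁻¹' E)ᶜ) {h : α → ℂ} (hh : Measurable h) :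
    IntertwinesMul K h (h ∘ τ) := by
  intro g g' hg
  suffices (fun x => K g' x - h x * K g x) =ᵐ[μ] 0 by
    filter_upwards [this] with x hx using sub_eq_zero.1 hx
  refine ae_eq_zero_of_forall_exists_norm_le (C := ‖K‖ * ‖g‖ + ‖K g‖) fun δ hδ => ?_
  obtain ⟨N, c, hN, happrox⟩ := exists_measurable_nat_norm_sub_le hh hδ
  have hmeas : Measurable fun x => h x - c (N x) := hh.sub ((measurable_from_nat (f := c)).comp hN)
  obtain ⟨r, hr, hrnorm⟩ := exists_ae_eq_mul_norm_le (f := g)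
    (hmeas.comp hτ).aestronglyMeasurable (Filter.Eventually.of_forall fun y _ => happrox (τ y))
  obtain ⟨q, hq, hqnorm⟩ := exists_ae_eq_mul_norm_le (f := K g)
    hmeas.aestronglyMeasurable (Filter.Eventually.of_forall fun x _ => happrox x)
  have hstep : ∀ᵐ y ∂ν, (g' - r) y = c (N (τ y)) * g y := by
    filter_upwards [hg, hr, Lp.coeFn_sub g' r] with y hy hry hsub
    rw [hsub, Pi.sub_apply, hy, hry]
    simp only [Function.comp_apply]
    ring
  refine ⟨K r - q, ?_, ?_⟩
  · have hKstep := intertwinesMul_comp_nat hK hN c hstep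
    rw [map_sub] at hKstep
    filter_upwards [hKstep, hq, Lp.coeFn_sub (K r) q, Lp.coeFn_sub (K g') (K r)]
      with x hx hqx hsub hsub'
    rw [hsub', Pi.sub_apply] at hx
    rw [hsub, Pi.sub_apply, hqx]
    linear_combination hx
  · calc ‖K r - q‖ ≤ ‖K r‖ + ‖q‖ := norm_sub_le _ _
      _ ≤ ‖K‖ * (δ * ‖g‖) + δ * ‖K g‖ := add_le_add (K.le_opNorm_of_le hrnorm) hqnorm
      _ = δ * (‖K‖ * ‖g‖ + ‖K g‖) := by ring

end Intertwining

section Translations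

/-- The translation `(T_z f)(y) = f (y + z)`, i.e. `exp (i z p̂)`. -/
def translation (z : ℝ) : H1 →L[ℂ] H1 :=
  (Lp.compMeasurePreservingₗᵢ ℂ _ (measurePreserving_add_right volume z)).toContinuousLinearMap

theorem translation_apply (z : ℝ) (f : H1) : ∀ᵐ y : ℝ, translation z f y = f (y + z) :=
  Lp.coeFn_compMeasurePreserving f (measurePreserving_add_right volume z)

theorem translation_zero : translation 0 = ContinuousLinearMap.id ℂ H1 := by
  ext1 f
  refine Lp.ext ?_
  filter_upwards [translation_apply 0 f] with y hy
  rw [hy, add_zero, ContinuousLinearMap.id_apply]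

theorem translation_add (a b : ℝ) : translation (a + b) = translation a ∘L translation b := by
  ext1 f
  refine Lp.ext ?_
  filter_upwards [translation_apply (a + b) f, translation_apply a (translation b f),
    (measurePreserving_add_right volume a).quasiMeasurePreserving.ae (translation_apply b f)]
    with y hab ha hb
  rw [hab, ContinuousLinearMap.comp_apply, ha, hb, add_assoc]

theorem translation_add_apply (a b : ℝ) (f : H1) :
    translation (a + b) f = translation a (translation b f) := by
  rw [translation_add, ContinuousLinearMap.comp_apply]

theorem translation_neg_apply_self (z : ℝ) (f : H1) :
    translation (-z) (translation z f) = f := by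
  rw [← translation_add_apply, neg_add_cancel, translation_zero, ContinuousLinearMap.id_apply]

theorem norm_translation_apply (z : ℝ) (f : H1) : ‖translation z f‖ = ‖f‖ :=
  (Lp.compMeasurePreservingₗᵢ ℂ _ (measurePreserving_add_right volume z)).norm_map f

theorem inner_translation_translation (z : ℝ) (f g : H1) :
    inner ℂ (translation z f) (translation z g) = inner ℂ f g :=
  (Lp.compMeasurePreservingₗᵢ ℂ _ (measurePreserving_add_right volume z)).inner_map_map f g

theorem inner_translation_right (z : ℝ) (f g : H1) :
    inner ℂ f (translation z g) = inner ℂ (translation (-z) f) g := by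
  rw [← inner_translation_translation (-z), translation_neg_apply_self]

theorem continuous_translation_apply (f : H1) : Continuous fun z => translation z f := by
  let g : ℝ → C(ℝ, ℝ) := fun z => ⟨fun y => y + z, by fun_prop⟩
  have hg : Continuous g := ContinuousMap.continuous_of_continuous_uncurry _ (by
    change Continuous fun q : ℝ × ℝ => q.2 + q.1
    fun_prop)
  exact (continuous_const (y := f)).compMeasurePreservingLp hg
    (measurePreserving_add_right volume) ENNReal.ofNat_ne_top

theorem translation_nat_mul_eq_self {a : ℝ} {f : H1} (hf : translation a f = f) (n : ℕ) :
    translation (n * a) f = f := by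
  induction n with
  | zero => rw [Nat.cast_zero, zero_mul, translation_zero, ContinuousLinearMap.id_apply]
  | succ n ih => rw [Nat.cast_succ, add_one_mul, translation_add_apply, hf, ih]

theorem setIntegral_Ioi_norm_sq_translation (z t : ℝ) (f : H1) :
    ∫ x in Set.Ioi t, ‖translation z f x‖ ^ 2 = ∫ x in Set.Ioi (t + z), ‖f x‖ ^ 2 := by
  rw [← (measurePreserving_add_right volume z).setIntegral_preimage_emb
      (measurableEmbedding_addRight z) (fun x => ‖f x‖ ^ 2) (Set.Ioi (t + z)),
    Set.preimage_add_const_Ioi, add_sub_cancel_right]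
  refine integral_congr_ae (ae_restrict_of_ae ?_)
  filter_upwards [translation_apply z f] with x hx
  rw [hx]

theorem eq_zero_of_forall_setIntegral_Ioi_norm_sq {f : H1}
    (hf : ∀ t, ∫ x in Set.Ioi t, ‖f x‖ ^ 2 = 0) : f = 0 := by
  have hint : Integrable fun x => ‖f x‖ ^ 2 :=
    (memLp_two_iff_integrable_sq_norm (Lp.aestronglyMeasurable f)).1 (Lp.memLp f)
  have hvan (n : ℕ) : ∀ᵐ x : ℝ, x ∈ Set.Ioi (-n : ℝ) → ‖f x‖ ^ 2 = 0 := by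
    rw [← ae_restrict_iff' measurableSet_Ioi]
    exact (integral_eq_zero_iff_of_nonneg (fun x => sq_nonneg _) hint.integrableOn).1 (hf _)
  refine vanishesOn_univ_iff.1 ?_
  filter_upwards [ae_all_iff.2 hvan] with x hx _
  obtain ⟨n, hn⟩ := exists_nat_gt (-x)
  simpa using hx n (neg_lt.1 hn)

theorem eq_zero_of_translation_eq_self {a : ℝ} (ha : a ≠ 0) {f : H1} (hf : translation a f = f) :
    f = 0 := by
  wlog hpos : 0 < a generalizing a
  · refine this (neg_ne_zero.2 ha) ?_ (neg_pos.2 (lt_of_le_of_ne (not_lt.1 hpos) ha))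
    conv_lhs => rw [← hf, translation_neg_apply_self]
  refine eq_zero_of_forall_setIntegral_Ioi_norm_sq fun t => ?_
  have htail (n : ℕ) : ∫ x in Set.Ioi (t + n * a), ‖f x‖ ^ 2 = ∫ x in Set.Ioi t, ‖f x‖ ^ 2 := by
    rw [← setIntegral_Ioi_norm_sq_translation, translation_nat_mul_eq_self hf]
  have hatTop : Filter.Tendsto (fun n : ℕ => t + n * a) Filter.atTop Filter.atTop :=
    Filter.tendsto_atTop_add_const_left _ t (tendsto_natCast_atTop_atTop.atTop_mul_const hpos)
  have hlim := tendsto_integral_Ioi_zero (f := fun x => ‖f x‖ ^ 2) (μ := volume) hatTop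
  simp only [htail] at hlim
  exact tendsto_nhds_unique tendsto_const_nhds hlim

/-- The pairs `(z, z')` with `T_z A = A T_{z'}`. They form the support relation of the second
factor of an invariant product operator with first factor `A`. -/
def translationRel (A : H1 →L[ℂ] H1) : AddSubgroup (ℝ × ℝ) where
  carrier := {q | ∀ f, translation q.1 (A f) = A (translation q.2 f)}
  zero_mem' f := by
    simp only [Prod.fst_zero, Prod.snd_zero, translation_zero, ContinuousLinearMap.id_apply]
  add_mem' {q r} hq hr f := by
    rw [Prod.fst_add, Prod.snd_add, translation_add_apply, hr, hq, ← translation_add_apply]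
  neg_mem' {q} hq f := by
    have h := hq (translation (-q.2) f)
    rw [← translation_add_apply, add_neg_cancel, translation_zero,
      ContinuousLinearMap.id_apply] at h
    rw [Prod.fst_neg, Prod.snd_neg, ← h, translation_neg_apply_self]

theorem isClosed_translationRel (A : H1 →L[ℂ] H1) :
    IsClosed (translationRel A : Set (ℝ × ℝ)) := by
  have hset : (translationRel A : Set (ℝ × ℝ)) =
      ⋂ f, {q | translation q.1 (A f) = A (translation q.2 f)} := by
    ext q
    simp only [Set.mem_iInter]
    rfl
  rw [hset]
  exact isClosed_iInter fun f => isClosed_eq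
    ((continuous_translation_apply _).comp continuous_fst)
    (A.continuous.comp ((continuous_translation_apply f).comp continuous_snd))

theorem swap_mem_translationRel {A : H1 →L[ℂ] H1} {c : ℂ} (hA : A = c • A.adjoint)
    {q : ℝ × ℝ} (hq : q ∈ translationRel A) : q.swap ∈ translationRel A := by
  have hadj (f : H1) : translation q.2 (A.adjoint f) = A.adjoint (translation q.1 f) := by
    refine ext_inner_left ℂ fun g => ?_
    have hneg := neg_mem hq g
    rw [inner_translation_right, ContinuousLinearMap.adjoint_inner_right,
      ContinuousLinearMap.adjoint_inner_right, inner_translation_right]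
    exact congrArg (inner ℂ · f) hneg.symm
  intro f
  rw [hA, smul_apply, map_smul, smul_apply]
  exact congrArg (c • ·) (hadj f)

theorem fst_eq_of_mem_translationRel {A : H1 →L[ℂ] H1} (hA : A ≠ 0) {ε : ℝ}
    (hε : ∀ a, (ε * a, a) ∈ translationRel A) {q : ℝ × ℝ} (hq : q ∈ translationRel A) :
    q.1 = ε * q.2 := by
  by_contra hne
  refine hA (ContinuousLinearMap.ext fun f => ?_)
  refine eq_zero_of_translation_eq_self (sub_ne_zero.2 hne) ?_
  have hdiff := sub_mem hq (hε q.2) f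
  simpa only [Prod.fst_sub, Prod.snd_sub, sub_self, translation_zero,
    ContinuousLinearMap.id_apply] using hdiff

/-- The correlation function `z ↦ ⟨f, T_z g⟩`. -/
def correlation (f g : H1) (z : ℝ) : ℂ := inner ℂ f (translation z g)

theorem continuous_correlation (f g : H1) : Continuous (correlation f g) :=
  continuous_const.inner (continuous_translation_apply g)

theorem memLp_top_correlation (f g : H1) : MemLp (correlation f g) ∞ (volume : Measure ℝ) := by
  refine memLp_top_of_bound (continuous_correlation f g).aestronglyMeasurable (‖f‖ * ‖g‖)
    (Filter.Eventually.of_forall fun z => ?_)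
  exact (norm_inner_le_norm _ _).trans_eq (by rw [norm_translation_apply])

end Translations

section ClosedSubgroups

theorem eq_top_or_countable_of_isClosed {S : AddSubgroup ℝ} (hS : IsClosed (S : Set ℝ)) :
    S = ⊤ ∨ (S : Set ℝ).Countable := by
  refine S.dense_or_cyclic.imp (fun hdense => ?_) fun ⟨a, ha⟩ => ?_
  · rw [← SetLike.coe_set_eq, ← hS.closure_eq, hdense.closure_eq, AddSubgroup.coe_top]
  · rw [ha, ← AddSubgroup.zmultiples_eq_closure, AddSubgroup.coe_zmultiples]
    exact Set.countable_range _

theorem forall_line_mem_or_countable {R : AddSubgroup (ℝ × ℝ)} (hR : IsClosed (R : Set (ℝ × ℝ)))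
    (ε : ℝ) : (∀ a, (ε * a, a) ∈ R) ∨ {a | (ε * a, a) ∈ R}.Countable := by
  have hclosed : IsClosed
      (R.comap ((AddMonoidHom.mulLeft ε).prod (AddMonoidHom.id ℝ)) : Set ℝ) :=
    hR.preimage (by fun_prop : Continuous fun a : ℝ => (ε * a, a))
  refine (eq_top_or_countable_of_isClosed hclosed).imp (fun htop a => ?_) id
  exact htop.ge (AddSubgroup.mem_top a)

-- A pair `q` is determined by `q + q.swap` and `q - q.swap`, which lie on the two diagonals.
theorem diagonal_or_antidiagonal_or_countable {R : AddSubgroup (ℝ × ℝ)}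
    (hR : IsClosed (R : Set (ℝ × ℝ))) (hswap : ∀ q ∈ R, q.swap ∈ R) :
    (∃ ε : ℝ, (ε = 1 ∨ ε = -1) ∧ ∀ a, (ε * a, a) ∈ R) ∨ (R : Set (ℝ × ℝ)).Countable := by
  rcases forall_line_mem_or_countable hR 1 with hdiag | hdiag
  · exact .inl ⟨1, .inl rfl, hdiag⟩
  rcases forall_line_mem_or_countable hR (-1) with hanti | hanti
  · exact .inl ⟨-1, .inr rfl, hanti⟩
  refine .inr (Set.MapsTo.countable_of_injOn (f := fun q => (q.1 + q.2, q.2 - q.1)) ?_ ?_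
    (hdiag.prod hanti))
  · intro q hq
    constructor
    · have hsum : q + q.swap ∈ R := add_mem hq (hswap q hq)
      rwa [show q + q.swap = (1 * (q.1 + q.2), q.1 + q.2) by
        ext <;> simp [add_comm]] at hsum
    · have hdiff : q - q.swap ∈ R := sub_mem hq (hswap q hq)
      rwa [show q - q.swap = (-1 * (q.2 - q.1), q.2 - q.1) by ext <;> simp] at hdiff
  · intro q _ r _ h
    obtain ⟨hsum, hdiff⟩ := Prod.mk.inj h
    ext <;> linarith

end ClosedSubgroups

section SupportRelation

variable {A K : H1 →L[ℂ] H1}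

/-- The relation between `A` and `K` that expresses, through matrix elements in the first factor,
that `A ⊗ K` commutes with the controlled translation `exp (i x̂_C p̂_B)`. -/
def IntertwinesCorrelations (A K : H1 →L[ℂ] H1) : Prop :=
  ∀ f g, IntertwinesMul K (correlation f (A g)) (correlation (A.adjoint f) g)

theorem IntertwinesCorrelations.blockZero (hK : IntertwinesCorrelations A K) {E F : Set ℝ}
    (hE : MeasurableSet E) (hF : MeasurableSet F)
    (hEF : Disjoint (E ×ˢ F) (translationRel A : Set (ℝ × ℝ))) : BlockZero K E F := by
  refine blockZero_of_forall_exists_intertwinesMul hE hF fun x hx y hy => ?_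
  have hxy : (x, y) ∉ translationRel A := Set.disjoint_left.1 hEF ⟨hx, hy⟩
  obtain ⟨g, hg⟩ := not_forall.1 hxy
  obtain ⟨f, hf⟩ := not_forall.1 (mt (ext_inner_left ℂ) hg)
  refine ⟨_, _, continuous_correlation f (A g), continuous_correlation (A.adjoint f) g, hK f g, ?_⟩
  rwa [correlation, correlation, ContinuousLinearMap.adjoint_inner_left]

theorem IntertwinesCorrelations.eq_zero_of_countable (hK : IntertwinesCorrelations A K)
    (hA : (translationRel A : Set (ℝ × ℝ)).Countable) : K = 0 := by
  have hproj : (Prod.fst '' (translationRel A : Set (ℝ × ℝ))).Countable := hA.image _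
  refine eq_zero_of_blockZero_univ (E := (Prod.fst '' (translationRel A : Set (ℝ × ℝ)))ᶜ)
    (hproj.ae_notMem volume) (hK.blockZero hproj.measurableSet.compl MeasurableSet.univ ?_)
  exact Set.disjoint_left.2 fun q hq hqA => hq.1 ⟨q, hqA, rfl⟩

theorem IntertwinesCorrelations.intertwinesMul_comp (hK : IntertwinesCorrelations A K)
    (hA : A ≠ 0) {ε : ℝ} (hε : ∀ a, (ε * a, a) ∈ translationRel A) {h : ℝ → ℂ}
    (hh : Measurable h) : IntertwinesMul K h fun x => h (ε * x) := by
  refine QRF.intertwinesMul_comp (measurable_const_mul ε) (fun E hE => ?_) hh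
  refine hK.blockZero hE (measurable_const_mul ε hE).compl (Set.disjoint_left.2 fun q hq hqA => ?_)
  have hmem : q.1 ∈ E := hq.1
  rw [fst_eq_of_mem_translationRel hA hε hqA] at hmem
  exact hq.2 hmem

theorem exists_sign_of_intertwinesCorrelations (hK : IntertwinesCorrelations A K) (hK₀ : K ≠ 0)
    {c : ℂ} (hA : A = c • A.adjoint) :
    ∃ ε : ℝ, (ε = 1 ∨ ε = -1) ∧ ∀ a, (ε * a, a) ∈ translationRel A :=
  (diagonal_or_antidiagonal_or_countable (isClosed_translationRel A)
    fun _ => swap_mem_translationRel hA).resolve_right (mt hK.eq_zero_of_countable hK₀)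

end SupportRelation

section QuasiCommutation

variable {T : H1 →ₗ.[ℂ] H1} {A : H1 →L[ℂ] H1}

/-- `T A = c A T` on the domain of `T`, which `A` preserves. The values `c = 1` and `c = -1` are
the vanishing of the commutator and of the anticommutator. -/
def QuasiCommutes (T : H1 →ₗ.[ℂ] H1) (A : H1 →L[ℂ] H1) (c : ℂ) : Prop :=
  ∀ f : T.domain, ∃ h : A f ∈ T.domain, T ⟨A f, h⟩ = c • A (T f)

theorem quasiCommutes_one_iff : QuasiCommutes T A 1 ↔ CommutatorZero T A := by
  simp only [QuasiCommutes, CommutatorZero, one_smul, sub_eq_zero]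

theorem quasiCommutes_neg_one_iff : QuasiCommutes T A (-1) ↔ AnticommutatorZero T A := by
  simp only [QuasiCommutes, AnticommutatorZero, neg_one_smul, eq_neg_iff_add_eq_zero]

end QuasiCommutation

section Position

variable {K : H1 →L[ℂ] H1}

theorem position_apply (f : position.domain) :
    ∀ᵐ x : ℝ, position f x = (x : ℂ) * (f : H1) x :=
  MemLp.coeFn_toLp f.2

theorem position_eq_of_ae {f g : H1} (hg : ∀ᵐ x : ℝ, g x = (x : ℂ) * f x) :
    ∃ h : f ∈ position.domain, position ⟨f, h⟩ = g := by
  have hmem : f ∈ position.domain := (Lp.memLp g).ae_eq hg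
  refine ⟨hmem, Lp.ext ?_⟩
  filter_upwards [hg, position_apply ⟨f, hmem⟩] with x hx hx'
  rw [hx, hx']

theorem IntertwinesMul.quasiCommutes_position {ε : ℝ}
    (hK : IntertwinesMul K Complex.ofReal fun x => Complex.ofReal (ε * x)) :
    QuasiCommutes position K ε := by
  intro f
  refine position_eq_of_ae ?_
  rw [← map_smul]
  refine hK ?_
  filter_upwards [Lp.coeFn_smul (ε : ℂ) (position f), position_apply f] with x hsmul hx
  rw [hsmul, Pi.smul_apply, hx, smul_eq_mul, Complex.ofReal_mul, mul_assoc]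

theorem eq_zero_of_position_eq_zero {f : position.domain} (hf : position f = 0) : (f : H1) = 0 := by
  refine vanishesOn_univ_iff.1 ?_
  filter_upwards [position_apply f, Lp.coeFn_zero ℂ 2 (volume : Measure ℝ),
    (Set.countable_singleton (0 : ℝ)).ae_notMem volume] with x hx hzero hne _
  rw [hf, hzero, Pi.zero_apply, eq_comm, mul_eq_zero, Complex.ofReal_eq_zero] at hx
  exact hx.resolve_left hne

theorem QuasiCommutes.eq_zero_of_ne {c c' : ℂ} (hK : QuasiCommutes position K c)
    (hK' : QuasiCommutes position K c') (hne : c ≠ c') : K = 0 := by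
  refine eq_zero_of_forall_mul Complex.measurable_ofReal fun g g' hg => ?_
  obtain ⟨hmem, rfl⟩ := position_eq_of_ae hg
  obtain ⟨hKg, hc⟩ := hK ⟨g, hmem⟩
  obtain ⟨_, hc'⟩ := hK' ⟨g, hmem⟩
  have hKpos : K (position ⟨g, hmem⟩) = 0 :=
    by_contra fun h => hne (smul_left_injective ℂ h (hc.symm.trans hc'))
  refine eq_zero_of_position_eq_zero (f := ⟨K g, hKg⟩) ?_
  rw [hc, hKpos, smul_zero]

end Position

section Momentum

/-- The bilinear pairing `f ↦ ∫ φ f` with a Schwartz function. -/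
def pairing (φ : 𝓢(ℝ, ℂ)) : H1 →L[ℂ] ℂ :=
  (ContinuousLinearMap.mul ℂ ℂ).lpPairing volume 2 2 (φ.toLp 2 volume)

theorem pairing_apply (φ : 𝓢(ℝ, ℂ)) (f : H1) : pairing φ f = ∫ x, φ x * f x := by
  rw [pairing, ContinuousLinearMap.lpPairing_eq_integral]
  refine integral_congr_ae ?_
  filter_upwards [φ.coeFn_toLp 2 volume] with x hx
  rw [hx, ContinuousLinearMap.mul_apply']

theorem toDist_apply (f : H1) (φ : 𝓢(ℝ, ℂ)) : toDist f φ = pairing φ f := by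
  rw [pairing_apply]
  exact Lp.toTemperedDistribution_apply f φ

theorem eq_of_forall_pairing {f g : H1} (h : ∀ φ, pairing φ f = pairing φ g) : f = g := by
  refine toDist_injective ?_
  ext φ
  rw [toDist_apply, toDist_apply, h]

theorem distDeriv_apply (f : H1) (φ : 𝓢(ℝ, ℂ)) :
    distDeriv f φ = -pairing (SchwartzMap.derivCLM ℂ ℂ φ) f := by
  change toDist f (-(SchwartzMap.derivCLM ℂ ℂ) φ) = _
  rw [map_neg, toDist_apply]

theorem pairing_translation (φ : 𝓢(ℝ, ℂ)) (f : H1) (z : ℝ) :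
    pairing φ (translation z f) = pairing (φ.compSubConstCLM ℂ z) f := by
  rw [pairing_apply, pairing_apply,
    ← integral_add_right_eq_self (fun x => φ.compSubConstCLM ℂ z x * f x) z]
  refine integral_congr_ae ?_
  filter_upwards [translation_apply z f] with x hx
  rw [hx, SchwartzMap.compSubConstCLM_apply, add_sub_cancel_right]

theorem exists_norm_apply_sub_le (φ : 𝓢(ℝ, ℂ)) :
    ∃ C, ∀ x z : ℝ, |z| ≤ 1 → ‖φ (x - z)‖ ≤ C * (1 + ‖x‖) ^ (-1 : ℝ) := by
  refine ⟨2 * (2 ^ 1 * ((Finset.Iic (1, 0)).sup fun m => SchwartzMap.seminorm ℂ m.1 m.2) φ),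
    fun x z hz => ?_⟩
  have h := SchwartzMap.one_add_le_sup_seminorm_apply (𝕜 := ℂ) (m := (1, 0)) (k := 1) (n := 0)
    le_rfl le_rfl φ (x - z)
  rw [norm_iteratedFDeriv_zero, pow_one] at h
  have hx : 1 + ‖x‖ ≤ 2 * (1 + ‖x - z‖) := by
    have := norm_add_le (x - z) z
    rw [sub_add_cancel, Real.norm_eq_abs z] at this
    linarith [norm_nonneg (x - z)]
  have hpos : 0 < 1 + ‖x‖ := by positivity
  rw [Real.rpow_neg_one, ← div_eq_mul_inv, le_div_iff₀ hpos]
  calc ‖φ (x - z)‖ * (1 + ‖x‖) ≤ ‖φ (x - z)‖ * (2 * (1 + ‖x - z‖)) := by gcongr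
    _ = 2 * ((1 + ‖x - z‖) * ‖φ (x - z)‖) := by ring
    _ ≤ _ := by gcongr

theorem memLp_one_add_norm_inv :
    MemLp (fun x : ℝ => (1 + ‖x‖) ^ (-1 : ℝ)) 2 (volume : Measure ℝ) := by
  have hm : AEStronglyMeasurable (fun x : ℝ => (1 + ‖x‖) ^ (-1 : ℝ)) volume :=
    (Continuous.rpow_const (by fun_prop) fun x => Or.inl (by positivity)).aestronglyMeasurable
  refine (memLp_two_iff_integrable_sq hm).2 ?_
  refine (integrable_one_add_norm (E := ℝ) (μ := volume) (r := 2) (by simp)).congr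
    (Filter.Eventually.of_forall fun x => ?_)
  dsimp only
  rw [← Real.rpow_natCast, ← Real.rpow_mul (by positivity)]
  norm_num

theorem hasDerivAt_pairing_translation_zero (φ : 𝓢(ℝ, ℂ)) (f : H1) :
    HasDerivAt (fun z => pairing φ (translation z f)) (distDeriv f φ) 0 := by
  obtain ⟨C, hC⟩ := exists_norm_apply_sub_le (SchwartzMap.derivCLM ℂ ℂ φ)
  have hf : AEStronglyMeasurable f volume := Lp.aestronglyMeasurable f
  have hderiv := hasDerivAt_integral_of_dominated_loc_of_deriv_le (𝕜 := ℝ)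
    (μ := (volume : Measure ℝ)) (F := fun z x => φ (x - z) * f x)
    (F' := fun z x => -SchwartzMap.derivCLM ℂ ℂ φ (x - z) * f x) (x₀ := 0)
    (bound := fun x => C * (1 + ‖x‖) ^ (-1 : ℝ) * ‖f x‖)
    (Metric.closedBall_mem_nhds (0 : ℝ) one_pos)
    (Filter.Eventually.of_forall fun z =>
      (φ.continuous.comp (continuous_id.sub continuous_const)).aestronglyMeasurable.mul hf)
    ?_ ?_ ?_ ?_ ?_
  · have hdist : distDeriv f φ = ∫ x, -SchwartzMap.derivCLM ℂ ℂ φ (x - 0) * f x := by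
      rw [distDeriv_apply, pairing_apply, ← integral_neg]
      simp
    rw [hdist]
    refine hderiv.2.congr_of_eventuallyEq (Filter.Eventually.of_forall fun z => ?_)
    dsimp only
    rw [pairing_translation, pairing_apply]
    rfl
  · simp only [sub_zero]
    exact (φ.memLp 2 volume).integrable_mul (Lp.memLp f)
  · exact (((SchwartzMap.derivCLM ℂ ℂ φ).continuous.comp
      (continuous_id.sub continuous_const)).neg.aestronglyMeasurable).mul hf
  · refine Filter.Eventually.of_forall fun x z hz => ?_
    rw [norm_mul, norm_neg]
    refine mul_le_mul_of_nonneg_right (hC x z ?_) (norm_nonneg _)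
    simpa using hz
  · exact (memLp_one_add_norm_inv.const_mul C).integrable_mul (Lp.memLp f).norm
  · refine Filter.Eventually.of_forall fun x z _ => ?_
    have hsub : HasDerivAt (fun z : ℝ => x - z) (-1) z := by
      simpa using (hasDerivAt_id z).const_sub x
    have hφ := (φ.hasDerivAt (x - z)).scomp z hsub
    rw [neg_smul, one_smul] at hφ
    exact hφ.mul_const (f x)

theorem hasDerivAt_pairing_translation (φ : 𝓢(ℝ, ℂ)) (f : H1) (z : ℝ) :
    HasDerivAt (fun z => pairing φ (translation z f))
      (distDeriv f (φ.compSubConstCLM ℂ z)) z := by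
  have h := hasDerivAt_pairing_translation_zero (φ.compSubConstCLM ℂ z) f
  rw [← sub_self z] at h
  have h' := h.comp_sub_const z z
  refine h'.congr_of_eventuallyEq (Filter.Eventually.of_forall fun t => ?_)
  dsimp only
  rw [← pairing_translation, ← translation_add_apply, add_sub_cancel]

theorem translation_sub_eq_integral {f g : H1} (h : distDeriv f = toDist g) (z : ℝ) :
    translation z f - f = ∫ s in 0..z, translation s g := by
  have hcont := continuous_translation_apply g
  refine eq_of_forall_pairing fun φ => ?_
  have hderiv (t : ℝ) : HasDerivAt (fun z => pairing φ (translation z f))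
      (pairing φ (translation t g)) t := by
    have := hasDerivAt_pairing_translation φ f t
    rwa [h, toDist_apply, ← pairing_translation] at this
  have hint : IntervalIntegrable (fun t => pairing φ (translation t g)) volume 0 z :=
    ((pairing φ).continuous.comp hcont).intervalIntegrable _ _
  rw [← ContinuousLinearMap.intervalIntegral_comp_comm _ (hcont.intervalIntegrable _ _),
    intervalIntegral.integral_eq_sub_of_hasDerivAt (fun t _ => hderiv t) hint,
    translation_zero, map_sub, ContinuousLinearMap.id_apply]

theorem hasDerivAt_translation_zero_iff {f g : H1} :
    HasDerivAt (fun z => translation z f) g 0 ↔ distDeriv f = toDist g := by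
  refine ⟨fun h => ?_, fun h => ?_⟩
  · ext φ
    rw [toDist_apply]
    exact (hasDerivAt_pairing_translation_zero φ f).unique
      (((pairing φ).hasFDerivAt.restrictScalars ℝ).comp_hasDerivAt (0 : ℝ) h)
  · have hint := ((continuous_translation_apply g).integral_hasStrictDerivAt 0 0).hasDerivAt
    rw [translation_zero, ContinuousLinearMap.id_apply] at hint
    refine (hint.add_const f).congr_of_eventuallyEq (Filter.Eventually.of_forall fun z => ?_)
    exact sub_eq_iff_eq_add.1 (translation_sub_eq_integral h z)

theorem hasDerivAt_translation_zero (f : momentum.domain) :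
    HasDerivAt (fun z => translation z (f : H1)) (Complex.I • momentum f) 0 := by
  rw [hasDerivAt_translation_zero_iff]
  change _ = toDist (Complex.I • -Complex.I • weakDeriv f)
  rw [smul_smul, mul_neg, Complex.I_mul_I, neg_neg, one_smul]
  exact (toDist_weakDeriv f).symm

theorem momentum_eq_of_hasDerivAt {f g : H1}
    (hg : HasDerivAt (fun z => translation z f) (Complex.I • g) 0) :
    ∃ h : f ∈ momentum.domain, momentum ⟨f, h⟩ = g := by
  have hdist := hasDerivAt_translation_zero_iff.1 hg
  have hmem : f ∈ momentum.domain := ⟨_, hdist.symm⟩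
  refine ⟨hmem, ?_⟩
  have hdiff := hasDerivAt_translation_zero ⟨f, hmem⟩
  exact smul_right_injective H1 Complex.I_ne_zero (hdiff.unique hg)

theorem quasiCommutes_momentum {A : H1 →L[ℂ] H1} {ε : ℝ}
    (hA : ∀ a, (a, ε * a) ∈ translationRel A) : QuasiCommutes momentum A ε := by
  intro f
  refine momentum_eq_of_hasDerivAt ?_
  have hline : HasDerivAt (fun a : ℝ => ε * a) ε 0 := by
    simpa using (hasDerivAt_id (0 : ℝ)).const_mul ε
  have hf := hasDerivAt_translation_zero f
  rw [← mul_zero ε] at hf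
  have hAf := (A.hasFDerivAt.restrictScalars ℝ).comp_hasDerivAt (0 : ℝ) (hf.scomp (0 : ℝ) hline)
  refine (hAf.congr_of_eventuallyEq (Filter.Eventually.of_forall fun a => hA a f)).congr_deriv ?_
  change A (ε • Complex.I • momentum f) = _
  rw [A.map_smul_of_tower, map_smul, smul_comm]
  exact congrArg (Complex.I • ·) (Complex.coe_smul ε _).symm

end Momentum

section ProductVectors

theorem tensor_apply (f g : H1) : ∀ᵐ q : ℝ × ℝ, tensor f g q = f q.1 * g q.2 :=
  (memLp_tensor f g).coeFn_toLp

theorem inner_tensor_tensor (f g f' g' : H1) :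
    inner ℂ (tensor f g) (tensor f' g') = inner ℂ f f' * inner ℂ g g' := by
  rw [L2.inner_def, L2.inner_def, L2.inner_def, ← integral_prod_mul]
  refine integral_congr_ae ?_
  filter_upwards [tensor_apply f g, tensor_apply f' g'] with q hfg hfg'
  rw [hfg, hfg']
  simp only [RCLike.inner_apply, map_mul]
  ring

theorem tensor_smul_left (c : ℂ) (f g : H1) : tensor (c • f) g = c • tensor f g := by
  refine Lp.ext ?_
  filter_upwards [tensor_apply (c • f) g, tensor_apply f g, Lp.coeFn_smul c (tensor f g),
    Measure.quasiMeasurePreserving_fst.ae (Lp.coeFn_smul c f)] with q hleft hfg hright hsmul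
  rw [hleft, hright, hsmul, Pi.smul_apply, Pi.smul_apply, hfg, smul_mul_assoc]

theorem tensor_smul_right (c : ℂ) (f g : H1) : tensor f (c • g) = c • tensor f g := by
  refine Lp.ext ?_
  filter_upwards [tensor_apply f (c • g), tensor_apply f g, Lp.coeFn_smul c (tensor f g),
    Measure.quasiMeasurePreserving_snd.ae (Lp.coeFn_smul c g)] with q hleft hfg hright hsmul
  rw [hleft, hright, hsmul, Pi.smul_apply, Pi.smul_apply, hfg, mul_smul_comm]

theorem tensor_zero_left (g : H1) : tensor 0 g = 0 := by
  simpa using tensor_smul_left 0 0 g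

theorem tensor_zero_right (f : H1) : tensor f 0 = 0 := by
  simpa using tensor_smul_right 0 f 0

theorem tensor_right_cancel {f g g' : H1} (hf : f ≠ 0) (h : tensor f g = tensor f g') : g = g' := by
  refine ext_inner_left ℂ fun u => ?_
  have h' := congrArg (fun ψ => inner ℂ (tensor f u) ψ) h
  simp only [inner_tensor_tensor] at h'
  exact mul_left_cancel₀ (inner_self_ne_zero.2 hf) h'

theorem ae_eq_zero_of_forall_setIntegral_prod {α β E : Type*} [MeasurableSpace α]
    [MeasurableSpace β] [NormedAddCommGroup E] [NormedSpace ℝ E] [CompleteSpace E]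
    {μ : Measure (α × β)} {f : α × β → E} (hf : Integrable f μ)
    (h : ∀ s t, MeasurableSet s → MeasurableSet t → ∫ q in s ×ˢ t, f q ∂μ = 0) : f =ᵐ[μ] 0 := by
  have hzero (s : Set (α × β)) (hs : MeasurableSet s) : ∫ q in s, f q ∂μ = 0 := by
    induction s, hs using MeasurableSpace.induction_on_inter generateFrom_prod.symm
      isPiSystem_prod with
    | empty => rw [setIntegral_empty]
    | basic _ hst =>
      obtain ⟨s, hs, t, ht, rfl⟩ := hst
      exact h s t hs ht
    | compl s hs ih =>
      have huniv := h Set.univ Set.univ MeasurableSet.univ MeasurableSet.univ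
      rw [Set.univ_prod_univ, setIntegral_univ] at huniv
      rw [setIntegral_compl hs hf, huniv, ih, sub_zero]
    | iUnion s hd hs ih =>
      rw [integral_iUnion hs hd hf.integrableOn]
      simp only [ih, tsum_zero]
  exact hf.ae_eq_of_forall_setIntegral_eq _ _ (integrable_zero _ _ _)
    fun s hs _ => by simpa using hzero s hs

theorem inner_tensor_indicatorConstLp {E F : Set ℝ} (hE : MeasurableSet E) (hF : MeasurableSet F)
    (hE' : volume E ≠ ∞) (hF' : volume F ≠ ∞) (ψ : H2) :
    inner ℂ (tensor (indicatorConstLp 2 hE hE' 1) (indicatorConstLp 2 hF hF' 1)) ψ =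
      ∫ q in E ×ˢ F, ψ q := by
  rw [L2.inner_def, ← integral_indicator (hE.prod hF)]
  refine integral_congr_ae ?_
  filter_upwards [tensor_apply (indicatorConstLp 2 hE hE' 1) (indicatorConstLp 2 hF hF' 1),
    Measure.quasiMeasurePreserving_fst.ae
      (indicatorConstLp_coeFn (p := 2) (hs := hE) (hμs := hE') (c := (1 : ℂ))),
    Measure.quasiMeasurePreserving_snd.ae
      (indicatorConstLp_coeFn (p := 2) (hs := hF) (hμs := hF') (c := (1 : ℂ)))]
    with q htensor hfst hsnd
  rw [htensor, hfst, hsnd]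
  by_cases hqE : q.1 ∈ E <;> by_cases hqF : q.2 ∈ F <;> simp [Set.indicator, hqE, hqF]

theorem vanishesOn_prod_of_forall_inner_tensor {ψ : H2} (h : ∀ f g, inner ℂ (tensor f g) ψ = 0)
    {E F : Set ℝ} (hE : MeasurableSet E) (hF : MeasurableSet F) (hE' : volume E ≠ ∞)
    (hF' : volume F ≠ ∞) : VanishesOn ψ (E ×ˢ F) := by
  have hfinite : Fact (volume (E ×ˢ F) < ∞) := ⟨by
    rw [Measure.volume_eq_prod, Measure.prod_prod]
    exact ENNReal.mul_lt_top hE'.lt_top hF'.lt_top⟩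
  have hint : Integrable ψ (volume.restrict (E ×ˢ F)) :=
    ((Lp.memLp ψ).restrict _).integrable one_le_two
  refine (ae_restrict_iff' (hE.prod hF)).1
    (ae_eq_zero_of_forall_setIntegral_prod hint fun s t hs ht => ?_)
  rw [Measure.restrict_restrict (hs.prod ht), Set.prod_inter_prod,
    ← inner_tensor_indicatorConstLp (hs.inter hE) (ht.inter hF)
      (measure_ne_top_of_subset Set.inter_subset_right hE')
      (measure_ne_top_of_subset Set.inter_subset_right hF'), h]

theorem eq_zero_of_forall_inner_tensor {ψ : H2} (h : ∀ f g, inner ℂ (tensor f g) ψ = 0) :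
    ψ = 0 := by
  have hbox (n : ℕ) : VanishesOn ψ (Set.Icc (-n : ℝ) n ×ˢ Set.Icc (-n : ℝ) n) :=
    vanishesOn_prod_of_forall_inner_tensor h measurableSet_Icc measurableSet_Icc
      measure_Icc_lt_top.ne measure_Icc_lt_top.ne
  refine vanishesOn_univ_iff.1 ?_
  filter_upwards [ae_all_iff.2 hbox] with q hq _
  obtain ⟨n, hn⟩ := exists_nat_ge (max |q.1| |q.2|)
  exact hq n ⟨abs_le.1 ((le_max_left _ _).trans hn), abs_le.1 ((le_max_right _ _).trans hn)⟩

theorem clm_eq_of_forall_tensor {A B : H2 →L[ℂ] H2}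
    (h : ∀ f g, A (tensor f g) = B (tensor f g)) : A = B := by
  refine ContinuousLinearMap.adjoint.injective (ContinuousLinearMap.ext fun ψ => ?_)
  refine sub_eq_zero.1 (eq_zero_of_forall_inner_tensor fun f g => ?_)
  rw [inner_sub_right, ContinuousLinearMap.adjoint_inner_right,
    ContinuousLinearMap.adjoint_inner_right, h, sub_self]

end ProductVectors

section ProductOperators

variable {O : H2 →L[ℂ] H2} {A B A' B' : H1 →L[ℂ] H1}

theorem IsTensorProduct.left_ne_zero (hO : IsTensorProduct O A B) (hne : O ≠ 0) : A ≠ 0 := by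
  rintro rfl
  exact hne (clm_eq_of_forall_tensor fun f g => by
    rw [hO, zero_apply, zero_apply, tensor_zero_left])

theorem IsTensorProduct.right_ne_zero (hO : IsTensorProduct O A B) (hne : O ≠ 0) : B ≠ 0 := by
  rintro rfl
  exact hne (clm_eq_of_forall_tensor fun f g => by
    rw [hO, zero_apply, zero_apply, tensor_zero_right])

theorem IsTensorProduct.adjoint (hO : IsTensorProduct O A B) :
    IsTensorProduct O.adjoint A.adjoint B.adjoint := by
  intro f g
  refine sub_eq_zero.1 (eq_zero_of_forall_inner_tensor fun f' g' => ?_)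
  rw [inner_sub_right, ContinuousLinearMap.adjoint_inner_right, hO, inner_tensor_tensor,
    inner_tensor_tensor, ContinuousLinearMap.adjoint_inner_right,
    ContinuousLinearMap.adjoint_inner_right, sub_self]

theorem IsTensorProduct.exists_left_eq_smul (hO : IsTensorProduct O A B)
    (hO' : IsTensorProduct O A' B') (hB : B ≠ 0) : ∃ c : ℂ, A = c • A' := by
  obtain ⟨g, hg⟩ := DFunLike.ne_iff.1 hB
  have hBg : inner ℂ (B g) (B g) ≠ (0 : ℂ) := inner_self_ne_zero.2 hg
  refine ⟨inner ℂ (B g) (B' g) / inner ℂ (B g) (B g), ContinuousLinearMap.ext fun f => ?_⟩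
  refine ext_inner_left ℂ fun u => ?_
  have hslice := congrArg (inner ℂ (tensor u (B g))) ((hO f g).symm.trans (hO' f g))
  rw [inner_tensor_tensor, inner_tensor_tensor] at hslice
  rw [smul_apply, inner_smul_right, div_mul_eq_mul_div, eq_div_iff hBg, hslice, mul_comm]

end ProductOperators

section Phases

/-- The phase `z ↦ exp (-i z P)` of the controlled translation. -/
def phase (P : ℝ) (z : ℝ) : ℂ := Complex.exp (-(Complex.I * z * P))

theorem norm_phase (P z : ℝ) : ‖phase P z‖ = 1 := by
  rw [phase, Complex.norm_exp]
  simp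

theorem phase_mul_phase_neg (P z : ℝ) : phase P z * phase (-P) z = 1 := by
  rw [phase, phase, ← Complex.exp_add]
  simp

theorem phase_neg_neg (P z : ℝ) : phase (-P) (-z) = phase P z := by
  simp [phase]

theorem measurable_phase (P : ℝ) : Measurable (phase P) := by
  unfold phase
  fun_prop

theorem memLp_top_phase (P : ℝ) : MemLp (phase P) ∞ (volume : Measure ℝ) :=
  memLp_top_of_bound (measurable_phase P).aestronglyMeasurable 1
    (Filter.Eventually.of_forall fun z => (norm_phase P z).le)

theorem countable_setOf_phase_eq_phase_neg {P : ℝ} (hP : P ≠ 0) :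
    {x : ℝ | phase P x = phase (-P) x}.Countable := by
  refine (Set.countable_range fun n : ℤ => -(n * Real.pi / P)).mono fun x hx => ?_
  obtain ⟨n, hn⟩ := Complex.exp_eq_exp_iff_exists_int.1 hx
  have him : -(x * P) = x * P + n * (2 * Real.pi) := by simpa using congrArg Complex.im hn
  refine ⟨n, ?_⟩
  field_simp
  linarith

end Phases

section ControlledTranslation

theorem expXP_eq_mulOp_comp (P : ℝ) : expXP P = mulOp (memLp_phase P) ∘L expXP 0 := by
  ext1 ψ
  refine eq_mulOp_of_ae (f := expXP 0 ψ) _ ?_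
  filter_upwards [expXP_apply P ψ, expXP_apply 0 ψ] with q hP h₀
  rw [hP, h₀]
  simp

theorem mulOp_phase_tensor (P : ℝ) (f g : H1) :
    mulOp (memLp_phase P) (tensor f g) = tensor f (mulOp (memLp_top_phase P) g) := by
  refine (eq_mulOp_of_ae _ ?_).symm
  filter_upwards [tensor_apply f g, tensor_apply f (mulOp (memLp_top_phase P) g),
    Measure.quasiMeasurePreserving_snd.ae (mulOp_apply (memLp_top_phase P) g)]
    with q hfg hfmul hmul
  rw [hfg, hfmul, hmul, phase, mul_left_comm]

theorem norm_expXP_apply (P : ℝ) (ψ : H2) : ‖expXP P ψ‖ = ‖ψ‖ := by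
  rw [← Lp.norm_compMeasurePreserving ψ measurePreserving_shear, Lp.norm_def, Lp.norm_def]
  refine congrArg ENNReal.toReal (eLpNorm_congr_norm_ae ?_)
  filter_upwards [expXP_apply P ψ, Lp.coeFn_compMeasurePreserving ψ measurePreserving_shear]
    with q hexp hcomp
  rw [hexp, hcomp, norm_mul]
  exact (congrArg (· * _) (norm_phase P q.2)).trans (one_mul _)

theorem surjective_expXP (P : ℝ) : Function.Surjective (expXP P) := by
  intro ψ
  have hmp : MeasurePreserving (fun q : ℝ × ℝ => (q.1 - q.2, q.2)) volume volume :=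
    measurePreserving_sub_prod (volume : Measure ℝ) (volume : Measure ℝ)
  let φ : H2 := mulOp (memLp_phase (-P)) ψ
  refine ⟨Lp.compMeasurePreserving _ hmp φ, Lp.ext ?_⟩
  filter_upwards [expXP_apply P (Lp.compMeasurePreserving _ hmp φ),
    measurePreserving_shear.quasiMeasurePreserving.ae (Lp.coeFn_compMeasurePreserving φ hmp),
    mulOp_apply (memLp_phase (-P)) ψ] with q hexp hcomp hmul
  rw [hexp, hcomp, Function.comp_apply, add_sub_cancel_right, hmul, ← mul_assoc]
  exact (congrArg (· * ψ q) (phase_mul_phase_neg P q.2)).trans (one_mul _)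

theorem expXP_mem_unitary (P : ℝ) : expXP P ∈ unitary (H2 →L[ℂ] H2) := by
  have hstar : star (expXP P) * expXP P = 1 :=
    (ContinuousLinearMap.norm_map_iff_adjoint_comp_self _).1 (norm_expXP_apply P)
  have hinj : Function.Injective (expXP P) :=
    ((AddMonoidHomClass.isometry_iff_norm _).2 (norm_expXP_apply P)).injective
  have hunit : IsUnit (expXP P) :=
    ContinuousLinearMap.isUnit_iff_bijective.2 ⟨hinj, surjective_expXP P⟩
  exact hunit.mem_unitary_of_star_mul_self hstar

theorem star_paritySwap_mul_self : star paritySwap * paritySwap = 1 :=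
  (ContinuousLinearMap.norm_map_iff_adjoint_comp_self _).1
    (Lp.compMeasurePreservingₗᵢ ℂ _ measurePreserving_paritySwap).norm_map

theorem inner_tensor_expXP_tensor (f g f' g' : H1) :
    inner ℂ (tensor f g) (expXP 0 (tensor f' g')) =
      inner ℂ g (mulOp (memLp_top_correlation f f') g') := by
  have hint := L2.integrable_inner (𝕜 := ℂ) (tensor f g) (expXP 0 (tensor f' g'))
  have hae : (fun q => inner ℂ (tensor f g q) (expXP 0 (tensor f' g') q)) =ᵐ[volume]
      fun q : ℝ × ℝ => inner ℂ (f q.1) (f' (q.1 + q.2)) * inner ℂ (g q.2) (g' q.2) := by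
    filter_upwards [tensor_apply f g, expXP_apply 0 (tensor f' g'),
      measurePreserving_shear.quasiMeasurePreserving.ae (tensor_apply f' g')]
      with q htensor hexp htensor'
    rw [htensor, hexp, htensor']
    simp only [RCLike.inner_apply, map_mul, Complex.ofReal_zero, mul_zero, neg_zero,
      Complex.exp_zero, one_mul]
    ring
  have hslice (z : ℝ) : ∫ y, inner ℂ (f y) (f' (y + z)) = correlation f f' z := by
    rw [correlation, L2.inner_def]
    refine integral_congr_ae ?_
    filter_upwards [translation_apply z f'] with y hy
    rw [hy]
  rw [inner_mulOp, L2.inner_def, integral_congr_ae hae, Measure.volume_eq_prod,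
    integral_prod_symm _ (by rw [← Measure.volume_eq_prod]; exact hint.congr hae)]
  simp only [integral_mul_const, hslice]

end ControlledTranslation

section Invariance

theorem conj_mul_eq_conj_iff_commute {M : Type*} [Monoid M] [StarMul M] {w u a : M}
    (hw : star w * w = 1) (hu : u ∈ unitary M) :
    w * u * a * star (w * u) = w * a * star w ↔ Commute u a := by
  have hcancel {b c : M} : w * b * star w = w * c * star w ↔ b = c := by
    refine ⟨fun h => ?_, fun h => h ▸ rfl⟩
    simpa only [mul_assoc, hw, mul_one, ← mul_assoc (star w) w, one_mul] using
      congrArg (star w * · * w) h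
  have hconj : u * a * star u = a ↔ u * a = a * u := by
    refine ⟨fun h => ?_, fun h => ?_⟩
    · conv_rhs => rw [← h, mul_assoc, Unitary.star_mul_self_of_mem hu, mul_one]
    · rw [h, mul_assoc, Unitary.mul_star_self_of_mem hu, mul_one]
  rw [star_mul, commute_iff_eq, ← hconj, ← hcancel (b := u * a * star u)]
  simp only [mul_assoc]

variable {O : H2 →L[ℂ] H2} {A B : H1 →L[ℂ] H1}

theorem invariant_iff_commute_expXP {P : ℝ} : Invariant P O ↔ Commute (expXP P) O :=
  conj_mul_eq_conj_iff_commute star_paritySwap_mul_self (expXP_mem_unitary P)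

theorem Invariant.iff_commute_mulOp_phase (hO : Invariant 0 O) {P : ℝ} :
    Invariant P O ↔ Commute (mulOp (memLp_phase P)) O := by
  rw [invariant_iff_commute_expXP] at hO ⊢
  rw [expXP_eq_mulOp_comp]
  let u : (H2 →L[ℂ] H2)ˣ := Unitary.toUnits ⟨expXP 0, expXP_mem_unitary 0⟩
  have hu : Commute (u : H2 →L[ℂ] H2) O := hO
  refine ⟨fun h => ?_, fun h => Commute.mul_left h hO⟩
  have hcancel := Commute.mul_left (a := mulOp (memLp_phase P) * u) h hu.units_inv_left
  rwa [Units.mul_inv_cancel_right] at hcancel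

theorem IsTensorProduct.commute_mulOp_phase_iff (hO : IsTensorProduct O A B) (hA : A ≠ 0) {P : ℝ} :
    Commute (mulOp (memLp_phase P)) O ↔ IntertwinesMul B (phase P) (phase P) := by
  rw [intertwinesMul_iff (memLp_top_phase P) (memLp_top_phase P)]
  have hleft (f g : H1) : mulOp (memLp_phase P) (O (tensor f g)) =
      tensor (A f) (mulOp (memLp_top_phase P) (B g)) := by
    rw [hO, mulOp_phase_tensor]
  have hright (f g : H1) : O (mulOp (memLp_phase P) (tensor f g)) =
      tensor (A f) (B (mulOp (memLp_top_phase P) g)) := by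
    rw [mulOp_phase_tensor, hO]
  refine ⟨fun h => ?_, fun h => clm_eq_of_forall_tensor fun f g => ?_⟩
  · obtain ⟨f, hf⟩ := DFunLike.ne_iff.1 hA
    refine ContinuousLinearMap.ext fun g => tensor_right_cancel hf ?_
    exact (hright f g).symm.trans ((DFunLike.congr_fun h.eq (tensor f g)).symm.trans (hleft f g))
  · exact (hleft f g).trans
      ((congrArg (tensor (A f)) (DFunLike.congr_fun h g).symm).trans (hright f g).symm)

theorem IsTensorProduct.invariant_iff (hO : IsTensorProduct O A B) (hne : O ≠ 0)
    (hinv : Invariant 0 O) {P : ℝ} : Invariant P O ↔ IntertwinesMul B (phase P) (phase P) :=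
  hinv.iff_commute_mulOp_phase.trans (hO.commute_mulOp_phase_iff (hO.left_ne_zero hne))

theorem IsTensorProduct.intertwinesCorrelations (hO : IsTensorProduct O A B)
    (hinv : Invariant 0 O) : IntertwinesCorrelations A B := by
  have hcomm := invariant_iff_commute_expXP.1 hinv
  intro f g
  rw [intertwinesMul_iff (memLp_top_correlation _ _) (memLp_top_correlation _ _)]
  refine ContinuousLinearMap.ext fun v => ext_inner_left ℂ fun u => ?_
  calc inner ℂ u (B (mulOp (memLp_top_correlation (A.adjoint f) g) v))
      = inner ℂ (O.adjoint (tensor f u)) (expXP 0 (tensor g v)) := by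
        rw [hO.adjoint, inner_tensor_expXP_tensor, ContinuousLinearMap.adjoint_inner_left]
    _ = inner ℂ (tensor f u) (O (expXP 0 (tensor g v))) :=
        ContinuousLinearMap.adjoint_inner_left _ _ _
    _ = inner ℂ (tensor f u) (expXP 0 (O (tensor g v))) :=
        congrArg _ (DFunLike.congr_fun hcomm.eq.symm (tensor g v))
    _ = inner ℂ u (mulOp (memLp_top_correlation f (A g)) (B v)) := by
        rw [hO, inner_tensor_expXP_tensor]

theorem intertwinesMul_phase_self_iff (hB : B ≠ 0) {ε : ℝ} (hε : ε = 1 ∨ ε = -1)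
    (hphase : ∀ P, IntertwinesMul B (phase P) fun x => phase P (ε * x)) {P : ℝ} (hP : P ≠ 0) :
    IntertwinesMul B (phase P) (phase P) ↔ ε = 1 := by
  rcases hε with rfl | rfl
  · simpa only [one_mul, iff_true] using hphase P
  · refine iff_of_false (fun h => hB ?_) (by norm_num)
    have hneg := hphase (-P)
    simp only [neg_one_mul, phase_neg_neg] at hneg
    exact h.eq_zero_of_ae_ne hneg (measurable_phase P)
      ((countable_setOf_phase_eq_phase_neg hP).ae_notMem volume)

theorem IsTensorProduct.exists_sign (hO : IsTensorProduct O A B) (hne : O ≠ 0)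
    (hself : IsSelfAdjoint O) (hinv : Invariant 0 O) :
    ∃ ε : ℝ, (ε = 1 ∨ ε = -1) ∧ QuasiCommutes momentum A ε ∧ QuasiCommutes position B ε ∧
      ∀ P ≠ 0, Invariant P O ↔ ε = 1 := by
  have hcorr := hO.intertwinesCorrelations hinv
  have hA := hO.left_ne_zero hne
  have hB := hO.right_ne_zero hne
  obtain ⟨c, hadj⟩ := hO.exists_left_eq_smul (hself.adjoint_eq ▸ hO.adjoint) hB
  obtain ⟨ε, hε, hline⟩ := exists_sign_of_intertwinesCorrelations hcorr hB hadj
  have hmul {h : ℝ → ℂ} (hh : Measurable h) : IntertwinesMul B h fun x => h (ε * x) :=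
    hcorr.intertwinesMul_comp hA hline hh
  exact ⟨ε, hε, quasiCommutes_momentum fun a => swap_mem_translationRel hadj (hline a),
    (hmul Complex.measurable_ofReal).quasiCommutes_position,
    fun P hP => (hO.invariant_iff hne hinv).trans
      (intertwinesMul_phase_self_iff hB hε (fun P => hmul (measurable_phase P)) hP)⟩

end Invariance

end QRF

end

theorem proposition1 (OB OC : QRF.H1 →L[ℂ] QRF.H1) (O : QRF.H2 →L[ℂ] QRF.H2)
    (hprod : QRF.IsTensorProduct O OB OC) (hne : O ≠ 0) (hherm : IsSelfAdjoint O)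
    (hinv : QRF.Invariant 0 O) :
    (∀ P : ℝ, P ≠ 0 →
      (¬ QRF.Invariant P O ↔
        QRF.AnticommutatorZero QRF.momentum OB ∧ QRF.AnticommutatorZero QRF.position OC)) ∧
    Xor (QRF.CommutatorZero QRF.momentum OB ∧ QRF.CommutatorZero QRF.position OC)
      (QRF.AnticommutatorZero QRF.momentum OB ∧ QRF.AnticommutatorZero QRF.position OC) ∧
    (QRF.CommutatorZero QRF.momentum OB ∧ QRF.CommutatorZero QRF.position OC →
      ∀ P : ℝ, QRF.Invariant P O) := by
  obtain ⟨ε, hε, hmom, hpos, hsector⟩ := hprod.exists_sign hne hherm hinv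
  simp only [← QRF.quasiCommutes_one_iff, ← QRF.quasiCommutes_neg_one_iff]
  have hexcl (h : QRF.QuasiCommutes QRF.position OC 1)
      (h' : QRF.QuasiCommutes QRF.position OC (-1)) : False :=
    hprod.right_ne_zero hne (h.eq_zero_of_ne h' (by norm_num))
  rcases hε with rfl | rfl
  · rw [Complex.ofReal_one] at hmom hpos
    have hall (P : ℝ) : QRF.Invariant P O :=
      (eq_or_ne P 0).elim (fun hP => hP ▸ hinv) fun hP => (hsector P hP).2 rfl
    exact ⟨fun P _ => iff_of_false (not_not.2 (hall P)) fun h => hexcl hpos h.2,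
      .inl ⟨⟨hmom, hpos⟩, fun h => hexcl hpos h.2⟩, fun _ => hall⟩
  · rw [Complex.ofReal_neg, Complex.ofReal_one] at hmom hpos
    exact ⟨fun P hP => iff_of_true (mt (hsector P hP).1 (by norm_num)) ⟨hmom, hpos⟩,
      .inr ⟨⟨hmom, hpos⟩, fun h => hexcl h.2 hpos⟩, fun h => (hexcl h.2 hpos).elim⟩
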